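/- **Model.** For an integer $m\ge1$ and real $\delta\ge 0$ (loops and parallel edges are allowed; a loop contributes $2$ to the degree), $\mathrm{PA}_1(1,\delta)$ is one vertex $v_1$ with a loop, and $\mathrm{PA}_{n+1}(1,\delta)$ arises from $\mathrm{PA}_n(1,\delta)$ by adding a vertex $v_{n+1}$ with one edge whose other end is $v_{n+1}$ with probability $\frac{1+\delta}{n(2+\delta)+1+\delta}$ and is $v_i$ $(i\le n)$ with probability $\frac{D_i(n)+\delta}{n(2+\delta)+1+\delta}$, where $D_i(n)$ is the degree of $v_i$ in $\mathrm{PA}_n(1,\delta)$. The multigraph $\mathrm{PA}_t(m,\delta)$ on $[t]=\{1,\dots,t\}$ is obtained from $\mathrm{PA}_{mt}(1,\delta/m)$ by contracting, for each $i\in[t]$, the vertices $v_{(i-1)m+1},\dots,v_{im}$ to the vertex $i$, keeping all loops and parallel edges. In the protocol $\mathcal{MP}^k$ ($k$ odd) on a multigraph, at each time step $\tau=1,2,\dots$ each vertex $v$, independently, chooses uniformly at random a set of $\min(k,\ell_v)$ of the half-edges at $v$, where $\ell_v$ is the largest odd number not exceeding the degree of $v$, and takes as its colour at time $\tau$ the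 majority, over the chosen half-edges, of the colours at time $\tau-1$ of the vertices at their other ends. **Lemma.** Let $m\ge 5$, let $k\ge5$ be odd, and let $d=\min(m,k)$ if $m$ is odd and $d=\min(m-1,k)$ if $m$ is even. Let $\alpha^*$ be the smallest positive solution $x\in(0,1]$ of $\Pr\big(\mathrm{Bin}(d-1,x)\ge\frac{d-1}{2}\big)=x$. Let $\varepsilon>0$ and $$\tau_*=B\log_d\log_d t,\qquad B=\frac{1+\varepsilon}{\log_d\left(\frac{d-1}{2}\right)} .$$ For a constant $A$ put $\omega=A\log\log t$ and $\kappa_o=(\log t)^{999\,\omega}$. There is a constant $A_0$, depending only on $m,k,\varepsilon$, such that for every constant $A\ge A_0$, every $\delta\ge0$ and every $\alpha$ with $0\le\alpha<\alpha^*$ the following holds. Suppose that at time $0$ each vertex of $\mathrm{PA}_t(m,\delta)$ is red with probability $\alpha$ and blue otherwise, independently of each other, of the graph and of the choices of the protocol. Then, with probability tending to $1$ as $t\to\infty$, under $\mathcal{MP}^k$ every vertex $v\in[t]$ with $v>\kappa_o$ is blue at the time steps $T+1$ and $T+2$, both for $T=\lfloor\tau_*\rfloor$ and for $T=\lceil\tau_*\rceil$.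 -/

import Mathlib

open MeasureTheory ProbabilityTheory Filter Topology
open scoped NNReal ENNReal

noncomputable section

namespace MajorityPA

/-! ### Multigraphs (loops and parallel edges allowed) -/

/-- A multigraph with vertex set `V` and edges indexed by `E`; the edge `e` joins `src e` and
`tgt e` (a loop if these agree). -/
structure Multigraph (V E : Type*) where
  src : E → V
  tgt : E → V

namespace Multigraph

variable {V E : Type*}

/-- Each edge `e` consists of two half-edges `(e, false)` and `(e, true)`. `base h` is the vertex
to which the half-edge `h` is attached. -/
def base (G : Multigraph V E) (h : E × Bool) : V :=
  if h.2 then G.tgt h.1 else G.src h.1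

/-- The vertex at the other end of the edge of the half-edge `h`. -/
def tip (G : Multigraph V E) (h : E × Bool) : V :=
  if h.2 then G.src h.1 else G.tgt h.1

/-- The half-edges attached to `v`, i.e. the list of neighbours of `v` with multiplicity. -/
def halfEdgesAt [Fintype E] [DecidableEq V] (G : Multigraph V E) (v : V) : Finset (E × Bool) :=
  Finset.univ.filter fun h => G.base h = v

/-- The degree of `v`; a loop counts twice. -/
def degree [Fintype E] [DecidableEq V] (G : Multigraph V E) (v : V) : ℕ :=
  (G.halfEdgesAt v).card

/-- Contraction of vertices along `f`, keeping all loops and parallel edges. -/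
def contract {W : Type*} (G : Multigraph V E) (f : V → W) : Multigraph W E where
  src := f ∘ G.src
  tgt := f ∘ G.tgt

theorem sum_degree [Fintype V] [Fintype E] [DecidableEq V] (G : Multigraph V E) :
    ∑ v, G.degree v = 2 * Fintype.card E := by
  unfold degree halfEdgesAt
  rw [← Finset.card_eq_sum_card_fiberwise (f := G.base) (s := Finset.univ) (t := Finset.univ)
    (fun _ _ => Finset.mem_coe.2 (Finset.mem_univ _))]
  simp [mul_comm]

end Multigraph

/-! ### The preferential attachment graph -/

/-- The possible values of the graph `PA_n(1, δ)`: vertices and edges are indexed by `0, …, n - 1`,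
and the `j`-th edge joins the `j`-th vertex to the vertex `e j ≤ j`. -/
abbrev PATree (n : ℕ) : Type := (j : Fin n) → Fin (j + 1)

/-- The multigraph on `Fin n` given by the choices of end vertices. -/
def PATree.graph {n : ℕ} (e : PATree n) : Multigraph (Fin n) (Fin n) where
  src j := j
  tgt j := Fin.castLE j.isLt (e j)

/-- The probability that the new vertex (number `n + 1`, i.e. index `n`) sends its edge to the
vertex of index `i`, given the present graph `e` on `n` vertices. -/
def attachWeight (δ : ℝ≥0) {n : ℕ} (e : PATree n) (i : Fin (n + 1)) : ℝ≥0∞ :=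
  if h : (i : ℕ) < n then
    ((e.graph.degree ⟨i, h⟩ : ℝ≥0) + δ) / ((n : ℝ≥0) * (2 + δ) + (1 + δ) : ℝ≥0)
  else
    (1 + δ) / ((n : ℝ≥0) * (2 + δ) + (1 + δ) : ℝ≥0)

theorem sum_attachWeight (δ : ℝ≥0) {n : ℕ} (e : PATree n) : ∑ i, attachWeight δ e i = 1 := by
  have hs : (∑ i : Fin n, (e.graph.degree i : ℝ≥0)) = 2 * n := by
    have := e.graph.sum_degree
    rw [Fintype.card_fin] at this
    exact_mod_cast this
  rw [Fin.sum_univ_castSucc]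
  simp only [attachWeight, Fin.val_castSucc, Fin.is_lt, dite_true, Fin.val_last, lt_irrefl,
    dite_false, Fin.eta, div_eq_mul_inv, ← Finset.sum_mul, ← add_mul]
  rw [← div_eq_mul_inv]
  have hc : (∑ i : Fin n, (((e.graph.degree i : ℝ≥0) : ℝ≥0∞) + (δ : ℝ≥0∞))) + (1 + (δ : ℝ≥0∞))
      = (((n : ℝ≥0) * (2 + δ) + (1 + δ) : ℝ≥0) : ℝ≥0∞) := by
    have : (n : ℝ≥0) * (2 + δ) + (1 + δ)
        = (∑ i : Fin n, ((e.graph.degree i : ℝ≥0) + δ)) + (1 + δ) := by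
      rw [Finset.sum_add_distrib, hs]
      simp
      ring
    rw [this]
    push_cast
    rfl
  rw [hc]
  refine ENNReal.div_self ?_ ENNReal.coe_ne_top
  have : (0 : ℝ≥0) < (n : ℝ≥0) * (2 + δ) + (1 + δ) := by positivity
  exact_mod_cast this.ne'

/-- The law of the end vertex of the edge added to the graph `e`. -/
def attachLaw (δ : ℝ≥0) {n : ℕ} (e : PATree n) : PMF (Fin (n + 1)) :=
  PMF.ofFintype (attachWeight δ e) (sum_attachWeight δ e)

/-- The graph `e` with one further vertex, whose edge goes to the vertex `i`. -/
def PATree.extend {n : ℕ} (e : PATree n) (i : Fin (n + 1)) : PATree (n + 1) :=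
  Fin.snoc (α := fun j : Fin (n + 1) => Fin (j + 1)) e i

/-- The law of `PA_n(1, δ)`. The step from `0` to `1` vertices creates a single vertex with a
loop, with probability one. -/
def paTreeLaw (δ : ℝ≥0) : (n : ℕ) → PMF (PATree n)
  | 0 => PMF.pure (fun j => j.elim0)
  | n + 1 => (paTreeLaw δ n).bind fun e => (attachLaw δ e).map e.extend

/-- The graph `PA_t(m, δ)` obtained from `PA_{tm}(1, δ/m)` by contracting consecutive blocks of `m`
vertices. The vertex `v : Fin t` is the vertex number `v + 1` of `{1, …, t}`. -/
def paGraph {m t : ℕ} (e : PATree (t * m)) : Multigraph (Fin t) (Fin (t * m)) :=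
  e.graph.contract Fin.divNat

/-! ### The `k`-choice local majority protocol

Colours are Booleans: `true` is red and `false` is blue. -/

section Protocol

variable {V E : Type*} [Fintype E] [DecidableEq V]

/-- The number of neighbours polled by `v`: `k` (which is odd) if `v` has at least `k` neighbours,
and otherwise the largest odd number that is at most the degree of `v`. -/
def pollSize (G : Multigraph V E) (k : ℕ) (v : V) : ℕ :=
  min k (if Odd (G.degree v) then G.degree v else G.degree v - 1)

theorem pollSize_le (G : Multigraph V E) (k : ℕ) (v : V) :
    pollSize G k v ≤ (G.halfEdgesAt v).card := by
  refine (min_le_right _ _).trans ?_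
  split_ifs
  · exact le_rfl
  · exact Nat.sub_le _ _

/-- The law of the poll of `v`: a uniformly random set of `pollSize G k v` half-edges at `v`. -/
def pollLaw (G : Multigraph V E) (k : ℕ) (v : V) : PMF (Finset (E × Bool)) :=
  PMF.uniformOfFinset ((G.halfEdgesAt v).powersetCard (pollSize G k v))
    (Finset.powersetCard_nonempty.2 (pollSize_le G k v))

/-- The colours at each time step, for the initial colouring `X₀` and the polls `N`; `N (τ, v)`
is the poll of `v` at time step `τ ≥ 1`. -/
def colour (G : Multigraph V E) (X₀ : V → Bool) (N : ℕ × V → Finset (E × Bool)) : ℕ → V → Bool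
  | 0 => X₀
  | τ + 1 => fun v =>
      decide ((N (τ + 1, v)).card <
        2 * ((N (τ + 1, v)).filter fun h => colour G X₀ N τ (G.tip h) = true).card)

/-- The law of the initial colouring and of all polls on a given graph: each vertex is initially red
with probability `α`, and all initial colours and all polls are independent. -/
def protocolLaw [Fintype V] (G : Multigraph V E) (k : ℕ) (α : unitInterval) :
    Measure ((V → Bool) × (ℕ × V → Finset (E × Bool))) :=
  (Measure.pi fun _ : V => bernoulliMeasure true false α).prod
    (Measure.infinitePi fun p : ℕ × V => (pollLaw G k p.2).toMeasure)

instance [Fintype V] (G : Multigraph V E) (k : ℕ) (α : unitInterval) :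
    IsProbabilityMeasure (protocolLaw G k α) := by
  unfold protocolLaw
  infer_instance

end Protocol

/-- The joint law of the graph `PA_t(m, δ)`, the initial colouring and the polls. -/
def jointLaw (m k : ℕ) (δ : ℝ≥0) (α : unitInterval) (t : ℕ) :
    Measure (PATree (t * m) ×
      ((Fin t → Bool) × (ℕ × Fin t → Finset (Fin (t * m) × Bool)))) :=
  (paTreeLaw (δ / m) (t * m)).toMeasure ⊗ₘ
    Kernel.ofFunOfCountable fun e => protocolLaw (paGraph e) k α

instance (m k : ℕ) (δ : ℝ≥0) (α : unitInterval) (t : ℕ) :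
    IsProbabilityMeasure (jointLaw m k δ α t) := by
  have : IsMarkovKernel (Kernel.ofFunOfCountable
      fun e : PATree (t * m) => protocolLaw (paGraph e) k α) :=
    ⟨fun e => inferInstanceAs (IsProbabilityMeasure (protocolLaw (paGraph e) k α))⟩
  unfold jointLaw
  infer_instance

/-! ### Parameters -/

/-- `d = m ∧ k` for odd `m` and `d = (m - 1) ∧ k` for even `m`. -/
def dParam (m k : ℕ) : ℕ := if Odd m then min m k else min (m - 1) k

/-- The smallest positive solution `x` of `P(Bin(d - 1, x) ≥ (d - 1) / 2) = x`. -/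
def alphaStar (d : ℕ) : ℝ :=
  sInf {x : ℝ | ∃ p : unitInterval, (p : ℝ) = x ∧ 0 < x ∧
    (binomial (d - 1) p).real {j : ℕ | ((d : ℝ) - 1) / 2 ≤ (j : ℝ)} = x}

/-- `τ_* = B log_d log_d t` with `B = (1 + ε) / log_d((d - 1) / 2)`. -/
def tauStar (d : ℕ) (ε : ℝ) (t : ℕ) : ℝ :=
  (1 + ε) / Real.logb d (((d : ℝ) - 1) / 2) * Real.logb d (Real.logb d t)

/-- `ω = A log log t`. -/
def omega (A : ℝ) (t : ℕ) : ℝ := A * Real.log (Real.log t)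

/-- `κ_o = (log t)^(999 ω)`; the outer core consists of the vertices with number at most `κ_o`. -/
def kappaO (A : ℝ) (t : ℕ) : ℝ := Real.log t ^ (999 * omega A t)

/-- All vertices outside the outer core are blue at time step `τ`. -/
def BlueOutsideCore {m t : ℕ} (A : ℝ) (e : PATree (t * m)) (X₀ : Fin t → Bool)
    (N : ℕ × Fin t → Finset (Fin (t * m) × Bool)) (τ : ℕ) : Prop :=
  ∀ v : Fin t, kappaO A t < (v : ℕ) + 1 → colour (paGraph e) X₀ N τ v = false

end MajorityPA

end

/-! Write d = 2h+1 and f(p) = P(Bin(2h,p) ≥ h). Call a half-edge clean if the nonbacktracking walks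
of length about τ_* that start with it are determined by their ends. Then the colour of its tip can
be followed as on a tree. Counting the base of the half-edge as always red (`guardedColour`) only
favours red and leaves branches that use disjoint sets of vertices, so the tip is red at time s with
probability at most the s-th iterate of f at α (`measureReal_guardedColour_le`). Larger polls do no
harm, since P(Bin(2i,p) ≥ i) decreases in i for p ≤ 1/2. Below α*, the least positive fixed point,
the iterates tend to 0; as f(p) = O(p^h) with h ≥ 2, they end up at most exp(-h^s), with s the
number of further steps. At τ_* the exponent is of order (log t)^(1+ε), and a union bound over the
2tm half-edges makes the tips of all clean half-edges blue.

It remains to bound the unclean half-edges at a vertex v. Each gives two walks with a common end,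
hence boundedly many edges, O(log log t) of them, forming a set without leaves except perhaps at v
(`exists_noLeafExcept_of_not_clean`). Three of them together give v degree at least 3 in such a set.
The probability that r prescribed edges are present is at most the product over the edges (j, i) of
(r+1)/√(ji), whatever δ is (`paTreeLaw_edges_le_prod`). Hence a vertex x of the configuration,
having degree at least 2, contributes at most 1/x, and v contributes at most v^(-3/2). Summing over
configurations costs (log t)^(O(log log t)), which the spare factor v^(-1/2) < κ_o^(-1/2) beats once
A is large (`tendsto_excess_sum`).

So with high probability each vertex beyond κ_o has at most two unclean half-edges. It polls at
least five, hence at most two of these show red, and it turns blue (`colour_succ_eq_false`). -/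

noncomputable section

namespace MajorityPA

/-! ### Binomial tails -/

/-- The probability that a binomial variable with parameters `n` and `p` is at least `a`. -/
def binTail : ℕ → ℕ → ℝ → ℝ
  | _, 0, _ => 1
  | 0, _ + 1, _ => 0
  | n + 1, a + 1, p => p * binTail n a p + (1 - p) * binTail n (a + 1) p

@[simp] theorem binTail_zero_right (n : ℕ) (p : ℝ) : binTail n 0 p = 1 := by
  cases n <;> rfl

@[simp] theorem binTail_zero_succ (a : ℕ) (p : ℝ) : binTail 0 (a + 1) p = 0 := rfl

theorem binTail_succ_succ (n a : ℕ) (p : ℝ) :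
    binTail (n + 1) (a + 1) p = p * binTail n a p + (1 - p) * binTail n (a + 1) p := rfl

theorem binTail_nonneg {p : ℝ} (h0 : 0 ≤ p) (h1 : p ≤ 1) (n a : ℕ) : 0 ≤ binTail n a p := by
  induction n generalizing a with
  | zero => cases a <;> simp
  | succ n ih =>
    cases a with
    | zero => simp
    | succ a =>
      rw [binTail_succ_succ]
      have := ih a
      have := ih (a + 1)
      have : 0 ≤ 1 - p := by linarith
      positivity

theorem binTail_succ_right_le {p : ℝ} (h0 : 0 ≤ p) (h1 : p ≤ 1) (n a : ℕ) :
    binTail n (a + 1) p ≤ binTail n a p := by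
  induction n generalizing a with
  | zero => cases a <;> simp
  | succ n ih =>
    cases a with
    | zero =>
      rw [binTail_succ_succ]
      have := ih 0
      simp only [binTail_zero_right] at *
      nlinarith
    | succ a =>
      rw [binTail_succ_succ, binTail_succ_succ]
      have h1' : 0 ≤ 1 - p := by linarith
      gcongr
      · exact ih a
      · exact ih (a + 1)

theorem binTail_eq_zero {n a : ℕ} (h : n < a) (p : ℝ) : binTail n a p = 0 := by
  induction n generalizing a with
  | zero => cases a <;> simp_all
  | succ n ih =>
    cases a with
    | zero => omega
    | succ a => rw [binTail_succ_succ, ih (by omega), ih (by omega)]; simp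

theorem binTail_sub_succ (n a : ℕ) (p : ℝ) :
    binTail n a p - binTail n (a + 1) p = n.choose a * p ^ a * (1 - p) ^ (n - a) := by
  induction n generalizing a with
  | zero => cases a <;> simp
  | succ n ih =>
    cases a with
    | zero =>
      have := ih 0
      simp only [binTail_zero_right, Nat.choose_zero_right, binTail_succ_succ, Nat.sub_zero,
        pow_zero, Nat.cast_one, mul_one, one_mul] at *
      rw [pow_succ', ← this]
      ring
    | succ a =>
      have e1 := ih a
      have e2 := ih (a + 1)
      rw [binTail_succ_succ, binTail_succ_succ, Nat.choose_succ_succ, Nat.add_sub_add_right]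
      have : p * binTail n a p + (1 - p) * binTail n (a + 1) p -
          (p * binTail n (a + 1) p + (1 - p) * binTail n (a + 1 + 1) p)
          = p * (binTail n a p - binTail n (a + 1) p)
            + (1 - p) * (binTail n (a + 1) p - binTail n (a + 1 + 1) p) := by ring
      rw [this, e1, e2]
      rcases lt_or_ge a n with h | h
      · obtain ⟨b, rfl⟩ := Nat.exists_eq_add_of_lt h
        rw [show a + b + 1 - a = b + 1 by omega, show a + b + 1 - (a + 1) = b by omega]
        push_cast
        ring
      -- For a ≥ n the truncated exponent n - (a+1) is wrong, but its coefficient vanishes.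
      · rw [Nat.choose_eq_zero_of_lt (show n < a + 1 by omega)]
        push_cast
        ring

theorem binomial_real_ge_eq_binTail (n a : ℕ) (p : unitInterval) :
    (binomial n p).real {j : ℕ | a ≤ j} = binTail n a p := by
  induction a with
  | zero => simp
  | succ a ih =>
    have hs : {j : ℕ | a + 1 ≤ j} = {j : ℕ | a ≤ j} \ {a} := by
      ext j
      simp only [Set.mem_ofPred_eq, Set.mem_sdiff, Set.mem_singleton_iff]
      omega
    rw [hs, measureReal_sdiff (by simp) (by simp), ih, binomial_real_singleton,
      ← binTail_sub_succ]
    ring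

theorem continuous_binTail (n a : ℕ) : Continuous (binTail n a) := by
  induction n generalizing a with
  | zero =>
    cases a with
    | zero => exact (continuous_const (y := (1 : ℝ))).congr fun x => by simp
    | succ a => exact (continuous_const (y := (0 : ℝ))).congr fun x => by simp
  | succ n ih =>
    cases a with
    | zero => exact (continuous_const (y := (1 : ℝ))).congr fun x => by simp
    | succ a =>
      exact ((continuous_id.mul (ih a)).add
        ((continuous_const.sub continuous_id).mul (ih (a + 1)))).congr fun x => rfl

theorem binTail_le_two_pow_mul {p : ℝ} (h0 : 0 ≤ p) (h1 : p ≤ 1) (n a : ℕ) :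
    binTail n a p ≤ 2 ^ n * p ^ a := by
  induction n generalizing a with
  | zero => cases a <;> simp [h0]
  | succ n ih =>
    cases a with
    | zero => simpa using one_le_pow₀ (n := n + 1) (one_le_two (α := ℝ))
    | succ a =>
      have e1 := ih a
      have e2 := ih (a + 1)
      have e3 := binTail_nonneg h0 h1 n (a + 1)
      calc binTail (n + 1) (a + 1) p ≤ p * (2 ^ n * p ^ a) + 1 * (2 ^ n * p ^ (a + 1)) := by
            rw [binTail_succ_succ]
            gcongr
            linarith
        _ = _ := by ring

/-- Exchange successes and failures: there are fewer than a successes exactly when there are at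
least b failures. -/
theorem binTail_add_binTail_compl {n a b : ℕ} (h : a + b = n + 1) (p : ℝ) :
    binTail n a p + binTail n b (1 - p) = 1 := by
  induction n generalizing a b with
  | zero =>
    have : (a = 0 ∧ b = 1) ∨ (a = 1 ∧ b = 0) := by omega
    rcases this with ⟨rfl, rfl⟩ | ⟨rfl, rfl⟩ <;> simp
  | succ n ih =>
    cases a with
    | zero => rw [binTail_eq_zero (show n + 1 < b by omega)]; simp
    | succ a =>
      cases b with
      | zero => rw [binTail_eq_zero (show n + 1 < a + 1 by omega)]; simp
      | succ b =>
        have e1 := ih (a := a) (b := b + 1) (by omega)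
        have e2 := ih (a := a + 1) (b := b) (by omega)
        rw [binTail_succ_succ, binTail_succ_succ]
        linear_combination p * e1 + (1 - p) * e2

theorem half_le_binTail_half (h : ℕ) : 1 / 2 ≤ binTail (2 * h) h (1 / 2) := by
  have e := binTail_add_binTail_compl (n := 2 * h) (a := h) (b := h + 1) (by omega) (1 / 2)
  have e2 := binTail_succ_right_le (p := 1 / 2) (by norm_num) (by norm_num) (2 * h) h
  norm_num at e e2 ⊢
  linarith

/-- Add two trials to the first 2a and raise the threshold from a to a+1. The event is gained only
from exactly a-1 successes followed by two more, and lost only from exactly a successes followed by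
two failures. The loss dominates, because the central binomial coefficient is the largest and p ≤
1-p. -/
theorem binTail_two_mul_succ_le {p : ℝ} (h0 : 0 ≤ p) (h1 : p ≤ 1 / 2) (a : ℕ) :
    binTail (2 * (a + 1)) (a + 1) p ≤ binTail (2 * a) a p := by
  cases a with
  | zero =>
    have := binTail_succ_right_le h0 (by linarith) 2 0
    simpa using this
  | succ a =>
    set n := 2 * (a + 1) with hn
    have e1 := binTail_sub_succ n a p
    have e2 := binTail_sub_succ n (a + 1) p
    rw [show n - a = a + 2 by omega] at e1
    rw [show n - (a + 1) = a + 1 by omega] at e2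
    rw [show 2 * (a + 1 + 1) = n + 1 + 1 by omega, binTail_succ_succ (n + 1),
      binTail_succ_succ n a, binTail_succ_succ n (a + 1)]
    have hch : ((n.choose a : ℕ) : ℝ) ≤ (n.choose (a + 1) : ℕ) := by
      have := Nat.choose_le_centralBinom a (a + 1)
      rw [Nat.centralBinom] at this
      exact_mod_cast this
    have key : p ^ 2 * (n.choose a * p ^ a * (1 - p) ^ (a + 2))
        ≤ (1 - p) ^ 2 * (n.choose (a + 1) * p ^ (a + 1) * (1 - p) ^ (a + 1)) := by
      have hq : 0 ≤ 1 - p := by linarith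
      have hpq : p ≤ 1 - p := by linarith
      calc p ^ 2 * (n.choose a * p ^ a * (1 - p) ^ (a + 2))
          = (n.choose a) * p * (p ^ (a + 1) * (1 - p) ^ (a + 2)) := by ring
        _ ≤ (n.choose (a + 1)) * (1 - p) * (p ^ (a + 1) * (1 - p) ^ (a + 2)) := by gcongr
        _ = _ := by ring
    rw [← e1, ← e2] at key
    linarith

theorem binTail_two_mul_anti {p : ℝ} (h0 : 0 ≤ p) (h1 : p ≤ 1 / 2) {i j : ℕ} (hij : i ≤ j) :
    binTail (2 * j) j p ≤ binTail (2 * i) i p := by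
  induction j, hij using Nat.le_induction with
  | base => exact le_rfl
  | succ j _ ih => exact (binTail_two_mul_succ_le h0 h1 j).trans ih

/-! ### The threshold -/

theorem alphaStar_eq (h : ℕ) :
    alphaStar (2 * h + 1) = sInf {x : ℝ | 0 < x ∧ x ≤ 1 ∧ binTail (2 * h) h x = x} := by
  unfold alphaStar
  congr 1
  ext x
  have hset : {j : ℕ | (((2 * h + 1 : ℕ) : ℝ) - 1) / 2 ≤ (j : ℝ)} = {j : ℕ | h ≤ j} := by
    ext j
    simp only [Set.mem_ofPred_eq]
    rw [← Nat.cast_le (α := ℝ)]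
    push_cast
    constructor <;> intro <;> linarith
  simp only [Set.mem_ofPred_eq, hset, Nat.add_sub_cancel, binomial_real_ge_eq_binTail]
  constructor
  · rintro ⟨p, rfl, h0, he⟩
    exact ⟨h0, p.2.2, he⟩
  · rintro ⟨h0, h1, he⟩
    exact ⟨⟨x, h0.le, h1⟩, rfl, h0, he⟩

/-- Near 0 the tail is O(x^h) with h ≥ 2 and so lies below the diagonal; at p it lies above. The
intermediate value theorem gives a fixed point in between. -/
theorem exists_fixed_binTail_le {h : ℕ} (hh : 2 ≤ h) {p : ℝ} (h0 : 0 < p) (h1 : p ≤ 1)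
    (hp : p ≤ binTail (2 * h) h p) :
    ∃ x, 0 < x ∧ x ≤ p ∧ binTail (2 * h) h x = x := by
  -- Small enough that 2^(2h) y ≤ 1, so that 2^(2h) y^2 ≤ y.
  set y : ℝ := min p ((2 ^ (2 * h + 1))⁻¹) with hy
  have hy0 : 0 < y := lt_min h0 (by positivity)
  have hyp : y ≤ p := min_le_left _ _
  have hlow : binTail (2 * h) h y ≤ y := by
    calc binTail (2 * h) h y ≤ 2 ^ (2 * h) * y ^ h :=
          binTail_le_two_pow_mul hy0.le (hyp.trans h1) _ _
      _ ≤ 2 ^ (2 * h) * y ^ 2 := by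
          gcongr 2 ^ (2 * h) * ?_
          exact pow_le_pow_of_le_one hy0.le (hyp.trans h1) hh
      _ = (2 ^ (2 * h) * y) * y := by ring
      _ ≤ 1 * y := by
          gcongr
          calc (2 : ℝ) ^ (2 * h) * y ≤ 2 ^ (2 * h) * (2 ^ (2 * h + 1))⁻¹ := by
                gcongr
                exact min_le_right _ _
            _ ≤ 1 := by
                rw [pow_succ]
                field_simp
                norm_num
      _ = y := one_mul y
  have hc : ContinuousOn (fun x => binTail (2 * h) h x - x) (Set.Icc y p) :=
    ((continuous_binTail _ _).sub continuous_id).continuousOn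
  obtain ⟨x, hx, hx0⟩ := intermediate_value_Icc hyp hc
    (Set.mem_Icc.2 ⟨sub_nonpos.2 hlow, sub_nonneg.2 hp⟩)
  exact ⟨x, hy0.trans_le hx.1, hx.2, by simpa [sub_eq_zero] using hx0⟩

theorem alphaStar_le {h : ℕ} (hh : 2 ≤ h) {p : ℝ} (h0 : 0 < p) (h1 : p ≤ 1)
    (hp : p ≤ binTail (2 * h) h p) : alphaStar (2 * h + 1) ≤ p := by
  obtain ⟨x, hx0, hxp, hx⟩ := exists_fixed_binTail_le hh h0 h1 hp
  rw [alphaStar_eq]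
  refine le_trans (csInf_le ⟨0, fun y hy => hy.1.le⟩ ?_) hxp
  exact ⟨hx0, hxp.trans h1, hx⟩

/-- By symmetry at p = 1/2. This keeps all red probabilities in the range where larger polls favour
blue. -/
theorem alphaStar_le_half {h : ℕ} (hh : 2 ≤ h) : alphaStar (2 * h + 1) ≤ 1 / 2 :=
  alphaStar_le hh (by norm_num) (by norm_num) (half_le_binTail_half h)

/-- The iterates of `p ↦ P(Bin(2h, p) ≥ h)`. -/
def redSeq (h : ℕ) (α : ℝ) : ℕ → ℝ
  | 0 => α
  | s + 1 => binTail (2 * h) h (redSeq h α s)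

section redSeq

variable {h : ℕ} {α : ℝ}

theorem binTail_le_self (hh : 2 ≤ h) {p : ℝ} (h0 : 0 ≤ p) (hp : p < alphaStar (2 * h + 1)) :
    binTail (2 * h) h p ≤ p := by
  have hhalf := alphaStar_le_half hh
  rcases h0.eq_or_lt with rfl | h0
  · have := binTail_le_two_pow_mul (p := 0) le_rfl zero_le_one (2 * h) h
    rwa [zero_pow (by omega), mul_zero] at this
  · by_contra! hlt
    exact absurd (alphaStar_le hh h0 (by linarith) hlt.le) (not_le.2 hp)

theorem redSeq_mem (hh : 2 ≤ h) (h0 : 0 ≤ α) (hα : α < alphaStar (2 * h + 1)) (s : ℕ) :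
    0 ≤ redSeq h α s ∧ redSeq h α s ≤ α := by
  have hhalf := alphaStar_le_half hh
  induction s with
  | zero => exact ⟨h0, le_rfl⟩
  | succ s ih =>
    obtain ⟨ih0, ih1⟩ := ih
    refine ⟨binTail_nonneg ih0 (by linarith) _ _, ?_⟩
    exact (binTail_le_self hh ih0 (by linarith)).trans ih1

theorem redSeq_antitone (hh : 2 ≤ h) (h0 : 0 ≤ α) (hα : α < alphaStar (2 * h + 1)) :
    Antitone (redSeq h α) :=
  antitone_nat_of_succ_le fun s =>
    binTail_le_self hh (redSeq_mem hh h0 hα s).1 ((redSeq_mem hh h0 hα s).2.trans_lt hα)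

theorem redSeq_le_half (hh : 2 ≤ h) (h0 : 0 ≤ α) (hα : α < alphaStar (2 * h + 1)) (s : ℕ) :
    redSeq h α s ≤ 1 / 2 := by
  have := alphaStar_le_half hh
  have := (redSeq_mem hh h0 hα s).2
  linarith

/-- The limit of the decreasing sequence is a fixed point below the least positive one, hence 0. -/
theorem tendsto_redSeq (hh : 2 ≤ h) (h0 : 0 ≤ α) (hα : α < alphaStar (2 * h + 1)) :
    Tendsto (redSeq h α) atTop (𝓝 0) := by
  have hhalf := alphaStar_le_half hh
  have hb : BddBelow (Set.range (redSeq h α)) :=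
    ⟨0, by rintro _ ⟨s, rfl⟩; exact (redSeq_mem hh h0 hα s).1⟩
  have ht := tendsto_atTop_ciInf (redSeq_antitone hh h0 hα) hb
  set l := ⨅ s, redSeq h α s with hl
  have hl0 : 0 ≤ l := le_ciInf fun s => (redSeq_mem hh h0 hα s).1
  have hlα : l ≤ α := ciInf_le hb 0
  have hfix : binTail (2 * h) h l = l :=
    tendsto_nhds_unique (((continuous_binTail (2 * h) h).tendsto l).comp ht)
      ((tendsto_add_atTop_iff_nat 1).2 ht)
  rcases hl0.eq_or_lt with h' | h'
  · rwa [← h'] at ht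
  · have := alphaStar_le hh h' (by linarith) hfix.ge
    linarith

/-- With C = 2^(2h), the rescaled iterate q = Cp satisfies q' ≤ C²p^h ≤ q^h because h ≥ 2; start it
once q < 1/e. -/
theorem exists_redSeq_le_exp (hh : 2 ≤ h) (h0 : 0 ≤ α) (hα : α < alphaStar (2 * h + 1)) :
    ∃ s₀ : ℕ, ∀ s, redSeq h α (s₀ + s) ≤ Real.exp (-(h : ℝ) ^ s) := by
  have hev : ∀ᶠ s in atTop, redSeq h α s < (2 ^ (2 * h))⁻¹ * Real.exp (-1) :=
    (tendsto_redSeq hh h0 hα).eventually_lt_const (by positivity)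
  obtain ⟨s₀, hs₀⟩ := hev.exists
  have hC : (1 : ℝ) ≤ 2 ^ (2 * h) := one_le_pow₀ one_le_two
  have key : ∀ s, 2 ^ (2 * h) * redSeq h α (s₀ + s) ≤ Real.exp (-(h : ℝ) ^ s) := by
    intro s
    induction s with
    | zero =>
      have := mul_le_mul_of_nonneg_left hs₀.le (show (0 : ℝ) ≤ 2 ^ (2 * h) by positivity)
      rw [← mul_assoc, mul_inv_cancel₀ (by positivity), one_mul] at this
      simpa using this
    | succ s ih =>
      have hm := redSeq_mem hh h0 hα (s₀ + s)
      have hhalf := redSeq_le_half hh h0 hα (s₀ + s)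
      calc 2 ^ (2 * h) * redSeq h α (s₀ + (s + 1))
          ≤ 2 ^ (2 * h) * (2 ^ (2 * h) * redSeq h α (s₀ + s) ^ h) := by
            gcongr
            exact binTail_le_two_pow_mul hm.1 (by linarith) _ _
        _ = (2 ^ (2 * h)) ^ 2 * redSeq h α (s₀ + s) ^ h := by ring
        _ ≤ (2 ^ (2 * h)) ^ h * redSeq h α (s₀ + s) ^ h := by
            have := pow_nonneg hm.1 h
            gcongr
        _ = (2 ^ (2 * h) * redSeq h α (s₀ + s)) ^ h := by rw [mul_pow]
        _ ≤ (Real.exp (-(h : ℝ) ^ s)) ^ h := by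
            have := hm.1
            gcongr
        _ = Real.exp (-(h : ℝ) ^ (s + 1)) := by
            rw [← Real.exp_nat_mul]
            congr 1
            ring
  refine ⟨s₀, fun s => le_trans ?_ (key s)⟩
  have := (redSeq_mem hh h0 hα (s₀ + s)).1
  nlinarith

end redSeq

/-! ### Nonbacktracking walks -/

namespace Multigraph

variable {V E : Type*}

/-- The other half of the edge of `h`. -/
def rev (h : E × Bool) : E × Bool := (h.1, !h.2)

@[simp] theorem rev_rev (h : E × Bool) : rev (rev h) = h := by simp [rev]

@[simp] theorem rev_fst (h : E × Bool) : (rev h).1 = h.1 := rfl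

theorem rev_injective : Function.Injective (rev : E × Bool → E × Bool) :=
  Function.LeftInverse.injective rev_rev

@[simp] theorem base_rev (G : Multigraph V E) (h : E × Bool) : G.base (rev h) = G.tip h := by
  rcases h with ⟨e, _ | _⟩ <;> rfl

/-- `h'` is a possible continuation of `h` in a nonbacktracking walk. -/
def Follows (G : Multigraph V E) (h h' : E × Bool) : Prop :=
  G.base h' = G.tip h ∧ h' ≠ rev h

/-- The nonbacktracking walks that start with the half-edge `h`; the last step is the head of
the list. -/
inductive NBWalk (G : Multigraph V E) (h : E × Bool) : List (E × Bool) → Prop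
  | single : NBWalk G h [h]
  | cons {g g' : E × Bool} {l : List (E × Bool)} :
      NBWalk G h (g :: l) → G.Follows g g' → NBWalk G h (g' :: g :: l)

/-- Lists hold the last step first, so a new initial step goes to the end of the list. -/
theorem NBWalk.append {G : Multigraph V E} {h h' : E × Bool} {l : List (E × Bool)}
    (hw : G.NBWalk h' l) (hf : G.Follows h h') : G.NBWalk h (l ++ [h]) := by
  induction hw with
  | single => exact .cons .single hf
  | cons _ hf' ih => exact .cons ih hf'

/-- Nonbacktracking walks of length at most `L` that start with `h` are determined by their end
vertices. -/
def Clean (G : Multigraph V E) (L : ℕ) (h : E × Bool) : Prop :=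
  ∀ ⦃g g' : E × Bool⦄ ⦃l l' : List (E × Bool)⦄, G.NBWalk h (g :: l) → G.NBWalk h (g' :: l') →
    l.length < L → l'.length < L → G.tip g = G.tip g' → g :: l = g' :: l'

theorem Clean.of_follows {G : Multigraph V E} {L : ℕ} {h h' : E × Bool} (hc : G.Clean (L + 1) h)
    (hf : G.Follows h h') : G.Clean L h' := by
  intro g g' l l' hw hw' hl hl' ht
  have := hc (hw.append hf) (hw'.append hf) (by simpa using hl) (by simpa using hl') ht
  exact List.append_left_injective [h] this

theorem Clean.mono {G : Multigraph V E} {L L' : ℕ} {h : E × Bool} (hc : G.Clean L h)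
    (hL : L' ≤ L) : G.Clean L' h :=
  fun _ _ _ _ hw hw' hl hl' ht => hc hw hw' (by omega) (by omega) ht

open Classical in
/-- The end vertices of the nonbacktracking walks of length at most `s + 1` that start
with `h`. -/
def reach [Fintype E] (G : Multigraph V E) : ℕ → E × Bool → Finset V
  | 0, h => {G.tip h}
  | s + 1, h => insert (G.tip h) ((Finset.univ.filter (G.Follows h)).biUnion (G.reach s))

section reach

variable [Fintype E] {G : Multigraph V E}

theorem tip_mem_reach (s : ℕ) (h : E × Bool) : G.tip h ∈ G.reach s h := by
  cases s <;> simp [reach]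

theorem reach_subset_reach_succ {s : ℕ} {h h' : E × Bool} (hf : G.Follows h h') :
    G.reach s h' ⊆ G.reach (s + 1) h := by
  classical
  intro u hu
  simp only [reach, Finset.mem_insert, Finset.mem_biUnion, Finset.mem_filter, Finset.mem_univ,
    true_and]
  exact Or.inr ⟨h', hf, hu⟩

theorem exists_walk_of_mem_reach {s : ℕ} {h : E × Bool} {u : V} (hu : u ∈ G.reach s h) :
    ∃ g l, G.NBWalk h (g :: l) ∧ l.length ≤ s ∧ G.tip g = u := by
  classical
  induction s generalizing h with
  | zero =>
    simp only [reach, Finset.mem_singleton] at hu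
    exact ⟨h, [], .single, by simp, hu.symm⟩
  | succ s ih =>
    simp only [reach, Finset.mem_insert, Finset.mem_biUnion, Finset.mem_filter, Finset.mem_univ,
      true_and] at hu
    rcases hu with rfl | ⟨h', hf, hu⟩
    · exact ⟨h, [], .single, by simp, rfl⟩
    · obtain ⟨g, l, hw, hl, ht⟩ := ih hu
      exact ⟨g, l ++ [h], hw.append hf, by simpa using hl, ht⟩

theorem Clean.tip_notMem_reach {s : ℕ} {h h' : E × Bool} (hc : G.Clean (s + 2) h)
    (hf : G.Follows h h') : G.tip h ∉ G.reach s h' := by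
  intro hu
  obtain ⟨g, l, hw, hl, ht⟩ := exists_walk_of_mem_reach hu
  have := hc (hw.append hf) .single (by simp; omega) (by simp) ht
  simp at this

/-- A common vertex would be the end of two walks from h, which cleanness identifies; but their
second steps differ. -/
theorem Clean.disjoint_reach {s : ℕ} {h h₁ h₂ : E × Bool} (hc : G.Clean (s + 2) h)
    (hf₁ : G.Follows h h₁) (hf₂ : G.Follows h h₂) (hne : h₁ ≠ h₂) :
    Disjoint (G.reach s h₁) (G.reach s h₂) := by
  rw [Finset.disjoint_left]
  intro u hu₁ hu₂
  obtain ⟨g₁, l₁, hw₁, hl₁, ht₁⟩ := exists_walk_of_mem_reach hu₁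
  obtain ⟨g₂, l₂, hw₂, hl₂, ht₂⟩ := exists_walk_of_mem_reach hu₂
  have happ := hc (hw₁.append hf₁) (hw₂.append hf₂) (by simp; omega) (by simp; omega)
    (ht₁.trans ht₂.symm)
  have : g₁ :: l₁ = g₂ :: l₂ := List.append_left_injective [h] happ
  -- The last list entry is the initial step, so equal lists force h₁ = h₂.
  have key : ∀ {k : E × Bool} {l : List (E × Bool)}, G.NBWalk k l → l.getLast? = some k := by
    intro k l hw
    induction hw with
    | single => rfl
    | cons _ _ ih => simpa using ih
  have e₁ := key hw₁
  rw [this, key hw₂] at e₁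
  exact hne (Option.some.inj e₁).symm

end reach

end Multigraph

open Multigraph

/-! ### The colour of a vertex one of whose neighbours is red -/

section Guarded

variable {V E : Type*}

open Classical in
/-- An upper bound for the colour of the tip of `h`: the colour that it has if the base of `h` is
always red, and likewise for its neighbours. -/
def guardedColour (G : Multigraph V E) (X₀ : V → Bool) (N : ℕ × V → Finset (E × Bool)) :
    ℕ → E × Bool → Bool
  | 0, h => X₀ (G.tip h)
  | s + 1, h => decide ((N (s + 1, G.tip h)).card <
      2 * ((N (s + 1, G.tip h)).filter fun h' =>
        G.Follows h h' → guardedColour G X₀ N s h' = true).card)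

theorem guardedColour_of_colour [Fintype E] [DecidableEq V] {G : Multigraph V E} {X₀ : V → Bool}
    {N : ℕ × V → Finset (E × Bool)} {s : ℕ} {h : E × Bool}
    (hc : colour G X₀ N s (G.tip h) = true) : guardedColour G X₀ N s h = true := by
  classical
  induction s generalizing h with
  | zero => exact hc
  | succ s ih =>
    simp only [colour, decide_eq_true_eq] at hc
    simp only [guardedColour, decide_eq_true_eq]
    refine hc.trans_le ?_
    gcongr 2 * Finset.card ?_
    intro h' hh'
    simp only [Finset.mem_filter] at hh' ⊢
    exact ⟨hh'.1, fun _ => ih hh'.2⟩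

/-- The initial colours and the polls as a single family. -/
def coord (i : V ⊕ ℕ × V) (ω : (V → Bool) × (ℕ × V → Finset (E × Bool))) :
    Bool × Finset (E × Bool) :=
  Sum.elim (fun v => (ω.1 v, ∅)) (fun p => (false, ω.2 p)) i

@[simp] theorem coord_inl (v : V) (ω : (V → Bool) × (ℕ × V → Finset (E × Bool))) :
    coord (.inl v) ω = (ω.1 v, ∅) := rfl

@[simp] theorem coord_inr (p : ℕ × V) (ω : (V → Bool) × (ℕ × V → Finset (E × Bool))) :
    coord (.inr p) ω = (false, ω.2 p) := rfl

/-- Whether `ω` is in `A` depends only on the coordinates in `I`. -/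
def Determined (I : Finset (V ⊕ ℕ × V)) (A : Set ((V → Bool) × (ℕ × V → Finset (E × Bool)))) :
    Prop :=
  ∀ ⦃ω ω'⦄, (∀ i ∈ I, coord i ω = coord i ω') → ω ∈ A → ω' ∈ A

section Determined

variable {I J : Finset (V ⊕ ℕ × V)} {A B : Set ((V → Bool) × (ℕ × V → Finset (E × Bool)))}

theorem Determined.iff (hA : Determined I A) {ω ω'} (h : ∀ i ∈ I, coord i ω = coord i ω') :
    ω ∈ A ↔ ω' ∈ A :=
  ⟨hA h, hA fun i hi => (h i hi).symm⟩

theorem Determined.compl (hA : Determined I A) : Determined I Aᶜ :=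
  fun _ _ h hω hω' => hω ((hA.iff h).2 hω')

end Determined

/-- The coordinates of the vertices in `U` up to time `s`. -/
def coordsUpTo (U : Finset V) (s : ℕ) : Finset (V ⊕ ℕ × V) :=
  U.disjSum (Finset.range (s + 1) ×ˢ U)

theorem coordsUpTo_mono {U U' : Finset V} {s s' : ℕ} (hU : U ⊆ U') (hs : s ≤ s') :
    coordsUpTo U s ⊆ coordsUpTo U' s' := by
  refine Finset.disjSum_mono hU (Finset.product_subset_product ?_ hU)
  exact Finset.range_subset_range.2 (by omega)

theorem disjoint_coordsUpTo {U U' : Finset V} (h : Disjoint U U') (s s' : ℕ) :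
    Disjoint (coordsUpTo U s) (coordsUpTo U' s') := by
  rw [Finset.disjoint_left] at h ⊢
  rintro (v | ⟨τ, v⟩) h1 h2 <;>
    simp only [coordsUpTo, Finset.inl_mem_disjSum, Finset.inr_mem_disjSum,
      Finset.mem_product] at h1 h2
  · exact h h1 h2
  · exact h h1.2 h2.2

theorem determined_guardedColour [Fintype E] (G : Multigraph V E) (s : ℕ) (h : E × Bool) :
    Determined (coordsUpTo (G.reach s h) s)
      {ω | guardedColour G ω.1 ω.2 s h = true} := by
  classical
  suffices H : ∀ ω ω' : (V → Bool) × (ℕ × V → Finset (E × Bool)),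
      (∀ i ∈ coordsUpTo (G.reach s h) s, coord i ω = coord i ω') →
        guardedColour G ω.1 ω.2 s h = guardedColour G ω'.1 ω'.2 s h by
    intro ω ω' hi hω
    exact (H ω ω' hi).symm.trans hω
  intro ω ω'
  induction s generalizing h with
  | zero =>
    intro hi
    have := hi (.inl (G.tip h)) (by simp [coordsUpTo, tip_mem_reach])
    simpa [guardedColour] using this
  | succ s ih =>
    intro hi
    have h1 := hi (.inr (s + 1, G.tip h)) (by simp [coordsUpTo, tip_mem_reach])
    have h2 : ω.2 (s + 1, G.tip h) = ω'.2 (s + 1, G.tip h) := by simpa using h1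
    have h3 : ∀ h', (G.Follows h h' → guardedColour G ω.1 ω.2 s h' = true) ↔
        (G.Follows h h' → guardedColour G ω'.1 ω'.2 s h' = true) := by
      intro h'
      refine forall_congr' fun hf => ?_
      rw [ih h' fun i hi' => hi i
        (coordsUpTo_mono (reach_subset_reach_succ hf) (Nat.le_succ s) hi')]
    simp only [guardedColour, h2, h3]

/-! ### Independence of the coordinates and the red probability on clean half-edges -/

theorem measurable_coord (i : V ⊕ ℕ × V) :
    Measurable (coord i : (V → Bool) × (ℕ × V → Finset (E × Bool)) → _) := by
  rcases i with v | p
  · exact ((measurable_pi_apply v).comp measurable_fst).prodMk measurable_const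
  · exact measurable_const.prodMk ((measurable_pi_apply p).comp measurable_snd)

variable {I J : Finset (V ⊕ ℕ × V)} {A B : Set ((V → Bool) × (ℕ × V → Finset (E × Bool)))}

/-- Reduces measurability and independence of determined events to those of finitely many
coordinates, which take values in a finite set when E is finite. -/
theorem Determined.eq_preimage (hA : Determined I A) :
    A = (fun ω (i : I) => coord (i : V ⊕ ℕ × V) ω) ⁻¹'
      ((fun ω (i : I) => coord (i : V ⊕ ℕ × V) ω) '' A) := by
  refine Set.Subset.antisymm (Set.subset_preimage_image _ _) ?_
  rintro ω ⟨ω', hω', he⟩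
  exact hA (fun i hi => congrFun he ⟨i, hi⟩) hω'

theorem Determined.measurableSet [Finite E] (hA : Determined I A) : MeasurableSet A := by
  rw [hA.eq_preimage]
  exact (measurable_pi_lambda _ fun i => measurable_coord _) (Set.toFinite _).measurableSet

theorem pollLaw_eq_zero [Fintype E] [DecidableEq V] (G : Multigraph V E) (k : ℕ) (v : V) {Q : Finset (E × Bool)}
    (hQ : Q ∉ (G.halfEdgesAt v).powersetCard (pollSize G k v)) : pollLaw G k v Q = 0 :=
  PMF.uniformOfFinset_apply_of_notMem _ hQ

variable [Fintype V] [Fintype E] [DecidableEq V]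

theorem iIndepFun_coord (G : Multigraph V E) (k : ℕ) (α : unitInterval) :
    iIndepFun (fun i : V ⊕ ℕ × V => coord i) (protocolLaw G k α) := by
  classical
  rw [iIndepFun_iff_measure_inter_preimage_eq_mul]
  intro S sets hs
  set μ := Measure.pi fun _ : V => bernoulliMeasure true false α with hμ
  set ν := Measure.infinitePi fun p : ℕ × V => (pollLaw G k p.2).toMeasure with hν
  have hP : protocolLaw G k α = μ.prod ν := rfl
  have hl (v : V) : (coord (.inl v) : (V → Bool) × (ℕ × V → Finset (E × Bool)) → _) ⁻¹'
      sets (.inl v) = {x | (x v, ∅) ∈ sets (.inl v)} ×ˢ Set.univ := by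
    ext ω; simp
  have hr (p : ℕ × V) : (coord (.inr p) : (V → Bool) × (ℕ × V → Finset (E × Bool)) → _) ⁻¹'
      sets (.inr p) = Set.univ ×ˢ {x | (false, x p) ∈ sets (.inr p)} := by
    ext ω; simp
  have hinter : (⋂ i ∈ S, (coord i : (V → Bool) × (ℕ × V → Finset (E × Bool)) → _) ⁻¹' sets i)
      = (⋂ v ∈ S.toLeft, {x | (x v, ∅) ∈ sets (.inl v)}) ×ˢ
        (⋂ p ∈ S.toRight, {x | (false, x p) ∈ sets (.inr p)}) := by
    ext ω
    simp [Sum.forall]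
  have hμi := iIndepFun_pi (μ := fun _ : V => bernoulliMeasure true false α)
    (X := fun _ (b : Bool) => (b, (∅ : Finset (E × Bool))))
    (fun _ => (measurable_id.prodMk measurable_const).aemeasurable)
  have hνi := iIndepFun_infinitePi (P := fun p : ℕ × V => (pollLaw G k p.2).toMeasure)
    (X := fun _ (b : Finset (E × Bool)) => (false, b))
    (fun _ => measurable_const.prodMk measurable_id)
  rw [iIndepFun_iff_measure_inter_preimage_eq_mul] at hμi hνi
  have e1 := hμi S.toLeft (sets := fun v => sets (.inl v)) (fun v hv => hs _ (by simpa using hv))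
  have e2 := hνi S.toRight (sets := fun p => sets (.inr p)) (fun v hv => hs _ (by simpa using hv))
  rw [hinter, hP, Measure.prod_prod]
  conv_rhs => rw [← Finset.toLeft_disjSum_toRight (u := S), Finset.prod_disjSum]
  congr 1
  · refine e1.trans (Finset.prod_congr rfl fun v _ => ?_)
    rw [hl, Measure.prod_prod, measure_univ, mul_one]
    rfl
  · refine e2.trans (Finset.prod_congr rfl fun v _ => ?_)
    rw [hr, Measure.prod_prod, measure_univ, one_mul]
    rfl

theorem Determined.measure_inter (hA : Determined I A) (hB : Determined J B) (hIJ : Disjoint I J)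
    (G : Multigraph V E) (k : ℕ) (α : unitInterval) :
    (protocolLaw G k α).real (A ∩ B)
      = (protocolLaw G k α).real A * (protocolLaw G k α).real B := by
  have h := (iIndepFun_coord G k α).indepFun_finset I J hIJ measurable_coord
  rw [indepFun_iff_measure_inter_preimage_eq_mul] at h
  have := h _ _ (Set.toFinite ((fun ω (i : I) => coord (i : V ⊕ ℕ × V) ω) '' A)).measurableSet
    (Set.toFinite ((fun ω (i : J) => coord (i : V ⊕ ℕ × V) ω) '' B)).measurableSet
  rw [← hA.eq_preimage, ← hB.eq_preimage] at this
  simp [measureReal_def, this]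

/-- Independent events of probability at most p are dominated by p-coins: revealing them one at a
time reproduces the recursion of `binTail`. The extra event B, independent of them, will fix the
outcome of a poll. -/
theorem measure_count_le (G : Multigraph V E) (k : ℕ) (α : unitInterval) {ι : Type*}
    {R : ι → (V → Bool) × (ℕ × V → Finset (E × Bool)) → Prop}
    [∀ i ω, Decidable (R i ω)] {K : ι → Finset (V ⊕ ℕ × V)}
    {p : ℝ} (h0 : 0 ≤ p) (h1 : p ≤ 1) (hB : Determined J B) (S : Finset ι)
    (hA : ∀ i ∈ S, Determined (K i) {ω | R i ω}) (hJ : ∀ i ∈ S, Disjoint (K i) J)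
    (hK : (S : Set ι).PairwiseDisjoint K) (hp : ∀ i ∈ S, (protocolLaw G k α).real {ω | R i ω} ≤ p)
    (a : ℕ) :
    (protocolLaw G k α).real {ω | ω ∈ B ∧ a ≤ (S.filter fun i => R i ω).card}
      ≤ (protocolLaw G k α).real B * binTail S.card a p := by
  classical
  induction S using Finset.induction_on generalizing a with
  | empty =>
    cases a with
    | zero => simp
    | succ a => simp
  | insert i S hi ih =>
    cases a with
    | zero => simp
    | succ a =>
      have hA' : ∀ j ∈ S, Determined (K j) {ω | R j ω} := fun j hj => hA j (Finset.mem_insert_of_mem hj)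
      specialize ih hA' (fun j hj => hJ j (Finset.mem_insert_of_mem hj))
        (hK.subset (by simp)) (fun j hj => hp j (Finset.mem_insert_of_mem hj))
      set C : ℕ → Set ((V → Bool) × (ℕ × V → Finset (E × Bool))) :=
        fun b => {ω | ω ∈ B ∧ b ≤ (S.filter fun j => R j ω).card} with hC
      have hCdet : ∀ b, Determined (J ∪ S.biUnion K) (C b) := by
        intro b ω ω' h
        have hb : ω ∈ B ↔ ω' ∈ B := hB.iff fun j hj => h j (Finset.mem_union_left _ hj)
        have hs : (S.filter fun j => R j ω) = S.filter fun j => R j ω' := by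
          refine Finset.filter_congr fun j hj => (hA' j hj).iff fun x hx => h x ?_
          exact Finset.mem_union_right _ (Finset.mem_biUnion.2 ⟨j, hj, hx⟩)
        simp only [hC, Set.mem_ofPred_eq, hb, hs, imp_self]
      have hd : Disjoint (K i) (J ∪ S.biUnion K) := by
        rw [Finset.disjoint_union_right, Finset.disjoint_biUnion_right]
        refine ⟨hJ i (Finset.mem_insert_self _ _), fun j hj => ?_⟩
        exact hK (by simp) (by simp [hj]) (by rintro rfl; exact hi hj)
      have hAi := hA i (Finset.mem_insert_self _ _)
      have hset : {ω | ω ∈ B ∧ a + 1 ≤ ((insert i S).filter fun j => R j ω).card}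
          ⊆ ({ω | R i ω} ∩ C a) ∪ ({ω | R i ω}ᶜ ∩ C (a + 1)) := by
        rintro ω ⟨hωB, hω⟩
        rw [Finset.filter_insert] at hω
        by_cases hωi : R i ω
        · rw [if_pos hωi, Finset.card_insert_of_notMem (by simp [hi])] at hω
          exact Or.inl ⟨hωi, hωB, by omega⟩
        · rw [if_neg hωi] at hω
          exact Or.inr ⟨hωi, hωB, hω⟩
      have hle : (protocolLaw G k α).real (C (a + 1)) ≤ (protocolLaw G k α).real (C a) :=
        measureReal_mono fun ω hω => ⟨hω.1, by have := hω.2; omega⟩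
      have hcompl : (protocolLaw G k α).real {ω | R i ω}ᶜ = 1 - (protocolLaw G k α).real {ω | R i ω} :=
        probReal_compl_eq_one_sub hAi.measurableSet
      have hpi := hp i (Finset.mem_insert_self _ _)
      calc (protocolLaw G k α).real {ω | ω ∈ B ∧ a + 1 ≤
              ((insert i S).filter fun j => R j ω).card}
          ≤ (protocolLaw G k α).real ({ω | R i ω} ∩ C a)
            + (protocolLaw G k α).real ({ω | R i ω}ᶜ ∩ C (a + 1)) :=
            (measureReal_mono hset).trans (measureReal_union_le _ _)
        _ = (protocolLaw G k α).real {ω | R i ω} * (protocolLaw G k α).real (C a)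
            + (1 - (protocolLaw G k α).real {ω | R i ω}) * (protocolLaw G k α).real (C (a + 1)) := by
            rw [hAi.measure_inter (hCdet a) hd, hAi.compl.measure_inter (hCdet (a + 1)) hd, hcompl]
        -- C (a+1) ⊆ C a, so the convex combination grows with the weight of C a.
        _ ≤ p * (protocolLaw G k α).real (C a)
            + (1 - p) * (protocolLaw G k α).real (C (a + 1)) := by nlinarith
        _ ≤ p * ((protocolLaw G k α).real B * binTail S.card a p)
            + (1 - p) * ((protocolLaw G k α).real B * binTail S.card (a + 1) p) := by
            have : 0 ≤ 1 - p := by linarith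
            gcongr
            · exact ih a
            · exact ih (a + 1)
        _ = _ := by
            rw [Finset.card_insert_of_notMem hi, binTail_succ_succ]
            ring

theorem measureReal_initial_red (G : Multigraph V E) (k : ℕ) (α : unitInterval) (v : V) :
    (protocolLaw G k α).real {ω | ω.1 v = true} = α := by
  have hset : {ω : (V → Bool) × (ℕ × V → Finset (E × Bool)) | ω.1 v = true}
      = ((fun x : V → Bool => x v) ⁻¹' {true}) ×ˢ Set.univ := by
    ext ω; simp
  have h : Measure.pi (fun _ : V => bernoulliMeasure true false α)
      ((fun x : V → Bool => x v) ⁻¹' {true}) = bernoulliMeasure true false α {true} :=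
    (measurePreserving_eval (fun _ : V => bernoulliMeasure true false α) v).measure_preimage
    (s := {true}) (MeasurableSet.singleton true).nullMeasurableSet
  rw [hset, measureReal_def, protocolLaw, Measure.prod_prod, measure_univ, mul_one, h,
    ← measureReal_def, bernoulliMeasure_real_apply_of_mem_of_notMem] <;> simp

theorem measureReal_poll_eq (G : Multigraph V E) (k : ℕ) (α : unitInterval) (p : ℕ × V)
    (Q : Finset (E × Bool)) :
    (protocolLaw G k α).real {ω | ω.2 p = Q} = (pollLaw G k p.2 Q).toReal := by
  have hset : {ω : (V → Bool) × (ℕ × V → Finset (E × Bool)) | ω.2 p = Q}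
      = Set.univ ×ˢ ((fun x : ℕ × V → Finset (E × Bool) => x p) ⁻¹' {Q}) := by
    ext ω; simp
  have h : Measure.infinitePi (fun p : ℕ × V => (pollLaw G k p.2).toMeasure)
      ((fun x : ℕ × V → Finset (E × Bool) => x p) ⁻¹' {Q}) = (pollLaw G k p.2).toMeasure {Q} :=
    (measurePreserving_eval_infinitePi
    (fun p : ℕ × V => (pollLaw G k p.2).toMeasure) p).measure_preimage
    (s := {Q}) (MeasurableSet.singleton Q).nullMeasurableSet
  rw [hset, measureReal_def, protocolLaw, Measure.prod_prod, measure_univ, one_mul, h,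
    PMF.toMeasure_apply_singleton _ _ (MeasurableSet.singleton Q)]

theorem sum_measureReal_poll (G : Multigraph V E) (k : ℕ) (α : unitInterval) (p : ℕ × V) :
    ∑ Q : Finset (E × Bool), (protocolLaw G k α).real {ω | ω.2 p = Q} = 1 := by
  simp only [measureReal_poll_eq]
  rw [← ENNReal.toReal_sum fun Q _ => PMF.apply_ne_top _ _, ← tsum_fintype (L := .unconditional _),
    PMF.tsum_coe, ENNReal.toReal_one]

/-- Fix the poll Q of the tip w. The polled half-edges other than `rev h₀` continue h₀; by cleanness
their reaches are disjoint and avoid w, so their guarded colours are independent of each other and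
of the poll, each red with probability at most p by induction. -/
theorem measureReal_guardedColour_le {G : Multigraph V E} {k h : ℕ} {α : unitInterval}
    (hh : 2 ≤ h) (hα : (α : ℝ) < alphaStar (2 * h + 1))
    (hpoll : ∀ v, ∃ i, h ≤ i ∧ pollSize G k v = 2 * i + 1) (s : ℕ) {h₀ : E × Bool}
    (hc : G.Clean (s + 1) h₀) :
    (protocolLaw G k α).real {ω | guardedColour G ω.1 ω.2 s h₀ = true} ≤ redSeq h α s := by
  classical
  induction s generalizing h₀ with
  | zero => exact (measureReal_initial_red G k α (G.tip h₀)).le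
  | succ s ih =>
    set w := G.tip h₀ with hw
    set p := redSeq h α s with hp
    have hp0 : 0 ≤ p := (redSeq_mem hh α.2.1 hα s).1
    have hp1 : p ≤ 1 / 2 := redSeq_le_half hh α.2.1 hα s
    set X := {ω : (V → Bool) × (ℕ × V → Finset (E × Bool)) |
      guardedColour G ω.1 ω.2 (s + 1) h₀ = true} with hX
    set B : Finset (E × Bool) → Set ((V → Bool) × (ℕ × V → Finset (E × Bool))) :=
      fun Q => {ω | ω.2 (s + 1, w) = Q} with hB
    have hBdet : ∀ Q, Determined (coordsUpTo {w} (s + 1)) (B Q) := by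
      intro Q ω ω' hi hω
      have := hi (.inr (s + 1, w)) (by simp [coordsUpTo])
      have h2 : ω.2 (s + 1, w) = ω'.2 (s + 1, w) := by simpa using this
      exact h2.symm.trans hω
    have hQ : ∀ Q, (protocolLaw G k α).real (X ∩ B Q)
        ≤ (protocolLaw G k α).real (B Q) * binTail (2 * h) h p := by
      intro Q
      by_cases hQm : Q ∈ (G.halfEdgesAt w).powersetCard (pollSize G k w)
      swap
      · have h0 : (protocolLaw G k α).real (B Q) = 0 := by
          rw [hB, measureReal_poll_eq, pollLaw_eq_zero G k _ hQm, ENNReal.toReal_zero]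
        rw [h0, zero_mul]
        exact (measureReal_mono Set.inter_subset_right).trans h0.le
      obtain ⟨i, hi, hq⟩ := hpoll w
      rw [hq, Finset.mem_powersetCard] at hQm
      obtain ⟨hQsub, hQcard⟩ := hQm
      have hfol : ∀ h' ∈ Q, h' ≠ rev h₀ → G.Follows h₀ h' := by
        intro h' hh' hne
        exact ⟨(Finset.mem_filter.1 (hQsub hh')).2, hne⟩
      have hcount : ∀ a, (protocolLaw G k α).real
          {ω | ω ∈ B Q ∧ a ≤ ((Q.erase (rev h₀)).filter fun h' => guardedColour G ω.1 ω.2 s h' = true).card}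
            ≤ (protocolLaw G k α).real (B Q) * binTail (Q.erase (rev h₀)).card a p := by
        intro a
        refine measure_count_le G k α
          (R := fun h' ω => guardedColour G ω.1 ω.2 s h' = true) (K := fun h' => coordsUpTo (G.reach s h') s) hp0
          (by linarith) (hBdet Q) _ (fun h' _ => determined_guardedColour G s h') ?_ ?_ ?_ a
        · intro h' hh'
          rw [Finset.mem_erase] at hh'
          refine disjoint_coordsUpTo ?_ _ _
          rw [Finset.disjoint_singleton_right]
          exact hc.tip_notMem_reach (hfol h' hh'.2 hh'.1)
        · intro h₁ hh₁ h₂ hh₂ hne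
          simp only [Finset.coe_erase, Set.mem_sdiff, Finset.mem_coe,
            Set.mem_singleton_iff] at hh₁ hh₂
          exact disjoint_coordsUpTo (hc.disjoint_reach (hfol h₁ hh₁.1 hh₁.2)
            (hfol h₂ hh₂.1 hh₂.2) hne) _ _
        · intro h' hh'
          rw [Finset.mem_erase] at hh'
          exact ih (hc.of_follows (hfol h' hh'.2 hh'.1))
      have hred : ∀ ω ∈ X ∩ B Q, 2 * i + 1 < 2 *
          (Q.filter fun h' => G.Follows h₀ h' → guardedColour G ω.1 ω.2 s h' = true).card := by
        rintro ω ⟨hωX, hωB⟩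
        simp only [hX, Set.mem_ofPred_eq, guardedColour, decide_eq_true_eq] at hωX
        rw [← hw, show ω.2 (s + 1, w) = Q from hωB, hQcard] at hωX
        exact hωX
      have hanti := binTail_two_mul_anti hp0 hp1 hi
      -- With 2i+1 polled, red needs i+1. If `rev h₀` is polled it counts as red, and i of the other
      -- 2i must be red. Otherwise i+1 of 2i+1 are needed, which is no likelier.
      by_cases hr : rev h₀ ∈ Q
      · refine (measureReal_mono ?_).trans ((hcount i).trans ?_)
        · intro ω hω
          have h1 := hred ω hω
          refine ⟨hω.2, ?_⟩
          have hsub : (Q.filter fun h' => G.Follows h₀ h' →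
              guardedColour G ω.1 ω.2 s h' = true) ⊆
              insert (rev h₀) ((Q.erase (rev h₀)).filter fun h' => guardedColour G ω.1 ω.2 s h' = true) := by
            intro h' hh'
            rw [Finset.mem_filter] at hh'
            by_cases hne : h' = rev h₀
            · simp [hne]
            · exact Finset.mem_insert_of_mem (Finset.mem_filter.2
                ⟨Finset.mem_erase.2 ⟨hne, hh'.1⟩, hh'.2 (hfol h' hh'.1 hne)⟩)
          have h2 := (Finset.card_le_card hsub).trans (Finset.card_insert_le _ _)
          omega
        · rw [Finset.card_erase_of_mem hr, hQcard, Nat.add_sub_cancel]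
          gcongr
      · refine (measureReal_mono ?_).trans ((hcount (i + 1)).trans ?_)
        · intro ω hω
          have h1 := hred ω hω
          refine ⟨hω.2, ?_⟩
          have hsub : (Q.filter fun h' => G.Follows h₀ h' →
              guardedColour G ω.1 ω.2 s h' = true) ⊆
              (Q.erase (rev h₀)).filter fun h' => guardedColour G ω.1 ω.2 s h' = true := by
            intro h' hh'
            rw [Finset.mem_filter] at hh'
            have hne : h' ≠ rev h₀ := by
              rintro rfl
              exact hr hh'.1
            exact Finset.mem_filter.2
                ⟨Finset.mem_erase.2 ⟨hne, hh'.1⟩, hh'.2 (hfol h' hh'.1 hne)⟩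
          have h2 := Finset.card_le_card hsub
          omega
        · rw [Finset.erase_eq_of_notMem hr, hQcard]
          gcongr
          refine le_trans ?_ hanti
          have := binTail_succ_right_le hp0 (by linarith) (2 * i) i
          rw [binTail_succ_succ]
          nlinarith
    calc (protocolLaw G k α).real X
        ≤ (protocolLaw G k α).real (⋃ Q ∈ (Finset.univ : Finset (Finset (E × Bool))), X ∩ B Q) :=
          measureReal_mono (fun ω hω => by simpa [hB] using hω) (measure_ne_top _ _)
      _ ≤ ∑ Q, (protocolLaw G k α).real (X ∩ B Q) := measureReal_biUnion_finset_le _ _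
      _ ≤ ∑ Q, (protocolLaw G k α).real (B Q) * binTail (2 * h) h p :=
          Finset.sum_le_sum fun Q _ => hQ Q
      _ = binTail (2 * h) h p := by
          rw [← Finset.sum_mul, sum_measureReal_poll, one_mul]

end Guarded

/-! ### The probability that given edges are present -/

section Attachment

variable {n : ℕ}

/-- The number of edges that were attached to the vertex of index `x`. -/
def indeg (e : PATree n) (x : ℕ) : ℕ := (Finset.univ.filter fun j : Fin n => (e j : ℕ) = x).card

theorem degree_graph (e : PATree n) (i : Fin n) : e.graph.degree i = 1 + indeg e i := by
  unfold Multigraph.degree Multigraph.halfEdgesAt indeg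
  rw [Finset.card_filter, Finset.card_filter, Fintype.sum_prod_type]
  simp only [Multigraph.base, PATree.graph, Fintype.sum_bool, if_true, Bool.false_eq_true,
    if_false, Finset.sum_add_distrib, Fin.ext_iff, Fin.val_castLE]
  rw [add_comm]
  congr 1
  simp [← Fin.ext_iff]

theorem indeg_eq_zero (e : PATree n) {x : ℕ} (hx : n ≤ x) : indeg e x = 0 := by
  rw [indeg, Finset.card_eq_zero, Finset.filter_eq_empty_iff]
  intro j _
  have := (e j).isLt
  have := j.isLt
  omega

theorem indeg_extend (e : PATree n) (i : Fin (n + 1)) (x : ℕ) :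
    indeg (e.extend i) x = indeg e x + if (i : ℕ) = x then 1 else 0 := by
  unfold indeg
  rw [Finset.card_filter, Finset.card_filter, Fin.sum_univ_castSucc]
  simp [PATree.extend]

/-- The weight `D_x + δ` of a vertex; a vertex that is not yet present gets the largest weight
that it can have when it appears. -/
def vertexWeight (δ : ℝ≥0) (e : PATree n) (x : ℕ) : ℝ≥0 :=
  if x < n then 1 + indeg e x + δ else 2 + δ

theorem vertexWeight_pos (δ : ℝ≥0) (e : PATree n) (x : ℕ) : 0 < vertexWeight δ e x := by
  unfold vertexWeight
  split_ifs <;> positivity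

theorem vertexWeight_extend_le (δ : ℝ≥0) (e : PATree n) (i : Fin (n + 1)) (x : ℕ) :
    vertexWeight δ (e.extend i) x
      ≤ vertexWeight δ e x + if (i : ℕ) = x ∧ x < n then 1 else 0 := by
  unfold vertexWeight
  rw [indeg_extend]
  rcases lt_trichotomy x n with h | rfl | h
  · rw [if_pos (by omega), if_pos h]
    simp only [h, and_true]
    split_ifs <;> push_cast <;> apply le_of_eq <;> ring
  · rw [if_pos (Nat.lt_succ_self x), if_neg (lt_irrefl x), indeg_eq_zero e le_rfl]
    have : ((if (i : ℕ) = x then 1 else 0 : ℕ) : ℝ≥0) ≤ 1 := by split_ifs <;> simp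
    calc 1 + ((0 + if (i : ℕ) = x then 1 else 0 : ℕ) : ℝ≥0) + δ ≤ 1 + 1 + δ := by
          rw [zero_add]
          gcongr
      _ ≤ _ := by
          rw [one_add_one_eq_two]
          exact le_self_add
  · rw [if_neg (by omega), if_neg (by omega)]
    exact le_self_add

/-- The normalization of the attachment probabilities. -/
def attachTotal (δ : ℝ≥0) (n : ℕ) : ℝ≥0 := n * (2 + δ) + (1 + δ)

theorem attachTotal_pos (δ : ℝ≥0) (n : ℕ) : 0 < attachTotal δ n := by
  unfold attachTotal
  positivity

theorem attachWeight_of_lt (δ : ℝ≥0) (e : PATree n) {i : Fin (n + 1)} (h : (i : ℕ) < n) :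
    attachWeight δ e i = (vertexWeight δ e i / attachTotal δ n : ℝ≥0) := by
  rw [attachWeight, dif_pos h, vertexWeight, if_pos h, degree_graph,
    ENNReal.coe_div (attachTotal_pos δ n).ne']
  push_cast
  rfl

theorem attachWeight_of_not_lt (δ : ℝ≥0) (e : PATree n) {i : Fin (n + 1)} (h : ¬ (i : ℕ) < n) :
    attachWeight δ e i = ((1 + δ) / attachTotal δ n : ℝ≥0) := by
  rw [attachWeight, dif_neg h, ENNReal.coe_div (attachTotal_pos δ n).ne']
  push_cast
  rfl

/-- The rising factorial `x (x + 1) ⋯ (x + r - 1)`. -/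
def rise (x : ℝ≥0) (r : ℕ) : ℝ≥0 := ∏ l ∈ Finset.range r, (x + l)

@[simp] theorem rise_zero (x : ℝ≥0) : rise x 0 = 1 := by simp [rise]

theorem rise_succ (x : ℝ≥0) (r : ℕ) : rise x (r + 1) = x * rise (x + 1) r := by
  rw [rise, Finset.prod_range_succ', rise, mul_comm]
  simp [add_comm, add_left_comm]

theorem rise_mono {x y : ℝ≥0} (h : x ≤ y) (r : ℕ) : rise x r ≤ rise y r :=
  Finset.prod_le_prod' fun _ _ => by gcongr

theorem rise_add_one (x : ℝ≥0) (r : ℕ) : x * rise (x + 1) r = rise x r * (x + r) := by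
  rw [← rise_succ, rise, Finset.prod_range_succ, rise]

/-- The number of the edges in `F` with index at least `n` that are to be attached to `i`. -/
def demand (F : Finset ℕ) (g : ℕ → ℕ) (n i : ℕ) : ℕ := (F.filter fun j => n ≤ j ∧ g j = i).card

/-- The product over the vertices of the rising factorials of the weights, as many factors as there
are edges still to be attached. -/
def potential (δ : ℝ≥0) (F : Finset ℕ) (g : ℕ → ℕ) (e : PATree n) : ℝ≥0 :=
  ∏ i ∈ F.image g, rise (vertexWeight δ e i) (demand F g n i)

variable {F : Finset ℕ} {g : ℕ → ℕ}

theorem demand_succ_of_notMem (hn : n ∉ F) (i : ℕ) : demand F g (n + 1) i = demand F g n i := by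
  unfold demand
  congr 1
  refine Finset.filter_congr fun j hj => ?_
  have : j ≠ n := by rintro rfl; exact hn hj
  constructor <;> rintro ⟨h1, h2⟩ <;> exact ⟨by omega, h2⟩

theorem demand_of_mem (hn : n ∈ F) (i : ℕ) :
    demand F g n i = demand F g (n + 1) i + if g n = i then 1 else 0 := by
  unfold demand
  have hF : F = insert n (F.erase n) := (Finset.insert_erase hn).symm
  have h1 : F.filter (fun j => n + 1 ≤ j ∧ g j = i)
      = (F.erase n).filter (fun j => n ≤ j ∧ g j = i) := by
    ext j
    simp only [Finset.mem_filter, Finset.mem_erase]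
    constructor
    · rintro ⟨h1, h2, h3⟩
      exact ⟨⟨by omega, h1⟩, by omega, h3⟩
    · rintro ⟨⟨h1, h2⟩, h3, h4⟩
      exact ⟨h2, by omega, h4⟩
  rw [h1]
  conv_lhs => rw [hF, Finset.filter_insert]
  split_ifs with h2 h3 h3
  · rw [Finset.card_insert_of_notMem (by simp)]
  · exact absurd h2.2 h3
  · exact absurd ⟨le_rfl, h3⟩ h2
  · rfl

/-- Only the factor of the vertex i can grow, when its weight x becomes x+1, and rise (x+1) r = rise
x r · (x+r)/x. -/
theorem potential_extend_le (δ : ℝ≥0) (hn : n ∉ F) (e : PATree n) (i : Fin (n + 1)) :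
    potential δ F g (e.extend i) ≤ potential δ F g e *
      if (i : ℕ) < n then (vertexWeight δ e i + demand F g n i) / vertexWeight δ e i else 1 := by
  set c : ℝ≥0 := (vertexWeight δ e i + demand F g n i) / vertexWeight δ e i with hc
  have hw := vertexWeight_pos δ e i
  have hc1 : 1 ≤ c := by
    rw [hc, le_div_iff₀ hw, one_mul]
    exact le_self_add
  have hfac : ∀ y ∈ F.image g, rise (vertexWeight δ (e.extend i) y) (demand F g (n + 1) y)
      ≤ rise (vertexWeight δ e y) (demand F g n y) *
        if y = (i : ℕ) then (if (i : ℕ) < n then c else 1) else 1 := by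
    intro y _
    rw [demand_succ_of_notMem hn]
    have hle := vertexWeight_extend_le δ e i y
    by_cases hy : y = (i : ℕ)
    · subst hy
      rw [if_pos rfl]
      by_cases hin : (i : ℕ) < n
      · rw [if_pos ⟨rfl, hin⟩] at hle
        rw [if_pos hin, hc, ← mul_div_assoc, le_div_iff₀ hw, ← rise_add_one, mul_comm]
        exact mul_le_mul_right (rise_mono hle _) _
      · rw [if_neg (by tauto), add_zero] at hle
        rw [if_neg hin, mul_one]
        exact rise_mono hle _
    · rw [if_neg hy, mul_one]
      rw [if_neg (by intro h; exact hy h.1.symm), add_zero] at hle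
      exact rise_mono hle _
  refine (Finset.prod_le_prod' hfac).trans ?_
  rw [Finset.prod_mul_distrib, Finset.prod_ite_eq']
  refine mul_le_mul_right ?_ _
  split_ifs <;> first | exact le_rfl | exact hc1

/-- A vertex of weight x and demand r is chosen with probability x/Z and then multiplies the
potential by at most 1 + r/x. The mean factor is thus at most 1 + Σr/Z, where Σr counts the pending
edges that aim at existing vertices. -/
theorem sum_attachWeight_mul_potential_le (δ : ℝ≥0) (hn : n ∉ F) (e : PATree n) :
    ∑ i, attachWeight δ e i * potential δ F g (e.extend i)
      ≤ ((1 + (F.filter fun j => g j < n ∧ n < j).card / attachTotal δ n : ℝ≥0) : ℝ≥0∞) *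
        potential δ F g e := by
  have hZ := attachTotal_pos δ n
  have hterm : ∀ i : Fin (n + 1), attachWeight δ e i * potential δ F g (e.extend i)
      ≤ potential δ F g e * (attachWeight δ e i +
        ((if (i : ℕ) < n then demand F g n i / attachTotal δ n else 0 : ℝ≥0) : ℝ≥0∞)) := by
    intro i
    have hle := potential_extend_le (g := g) δ hn e i
    have hle' : (potential δ F g (e.extend i) : ℝ≥0∞) ≤ _ := ENNReal.coe_le_coe.2 hle
    refine (mul_le_mul_right hle' _).trans (le_of_eq ?_)
    by_cases hin : (i : ℕ) < n
    · rw [if_pos hin, if_pos hin, attachWeight_of_lt δ e hin]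
      have hw := vertexWeight_pos δ e i
      norm_cast
      field_simp
    · rw [if_neg hin, if_neg hin]
      simp [mul_comm]
  refine (Finset.sum_le_sum fun i _ => hterm i).trans (le_of_eq ?_)
  rw [← Finset.mul_sum, Finset.sum_add_distrib, sum_attachWeight, mul_comm]
  congr 1
  have hcard : (F.filter fun j => g j < n ∧ n < j).card = ∑ i : Fin n, demand F g n i := by
    rw [Finset.sum_fin_eq_sum_range]
    rw [Finset.card_eq_sum_card_fiberwise (f := g) (t := Finset.range n)]
    · refine Finset.sum_congr rfl fun i hi => ?_
      rw [Finset.mem_range] at hi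
      rw [dif_pos hi, demand, Finset.filter_filter]
      congr 1
      refine Finset.filter_congr fun j hj => ?_
      have : j ≠ n := by rintro rfl; exact hn hj
      constructor
      · rintro ⟨⟨h1, h2⟩, h3⟩
        exact ⟨h2.le, h3⟩
      · rintro ⟨h1, h3⟩
        exact ⟨⟨by omega, by omega⟩, h3⟩
    · intro j hj
      simp only [Finset.coe_filter, Set.mem_ofPred_eq] at hj
      simpa using hj.2.1
  rw [hcard, Fin.sum_univ_castSucc]
  simp only [Fin.val_castSucc, Fin.is_lt, if_true, Fin.val_last, lt_irrefl, if_false]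
  push_cast
  rw [add_zero, ← ENNReal.ofNNReal_finsetSum, ← Finset.sum_div]

/-- The weight x in the probability x/Z is absorbed by x · rise (x+1) r = rise x (r+1), since the
demand drops by one. For a loop at the new vertex, the value 2+δ used before it appears covers the
weight 1+δ. -/
theorem attachWeight_mul_potential_le (δ : ℝ≥0) (hn : n ∈ F) (e : PATree n) {i : Fin (n + 1)}
    (hi : (i : ℕ) = g n) :
    attachWeight δ e i * potential δ F g (e.extend i)
      ≤ (((attachTotal δ n)⁻¹ : ℝ≥0) : ℝ≥0∞) * potential δ F g e := by
  have hgm : g n ∈ F.image g := Finset.mem_image_of_mem g hn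
  set w : ℝ≥0 := if (i : ℕ) < n then vertexWeight δ e i else 1 + δ with hw
  have haw : attachWeight δ e i = (w / attachTotal δ n : ℝ≥0) := by
    by_cases hin : (i : ℕ) < n
    · rw [attachWeight_of_lt δ e hin, hw, if_pos hin]
    · rw [attachWeight_of_not_lt δ e hin, hw, if_neg hin]
  have key : w * potential δ F g (e.extend i) ≤ potential δ F g e := by
    unfold potential
    rw [← Finset.mul_prod_erase _ _ hgm, ← Finset.mul_prod_erase _ _ hgm, ← mul_assoc]
    refine mul_le_mul' ?_ (Finset.prod_le_prod' fun y hy => ?_)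
    · rw [demand_of_mem hn, if_pos rfl, rise_succ, ← hi]
      have hle := vertexWeight_extend_le δ e i i
      by_cases hin : (i : ℕ) < n
      · rw [if_pos ⟨rfl, hin⟩] at hle
        rw [hw, if_pos hin]
        exact mul_le_mul_right (rise_mono hle _) _
      · rw [if_neg (by tauto), add_zero] at hle
        refine mul_le_mul' ?_ (rise_mono (hle.trans le_self_add) _)
        rw [hw, if_neg hin, vertexWeight, if_neg hin]
        gcongr
        exact one_le_two
    · rw [Finset.mem_erase] at hy
      rw [demand_of_mem hn, if_neg (Ne.symm hy.1), add_zero]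
      have hle := vertexWeight_extend_le δ e i y
      rw [if_neg (by rintro ⟨h, -⟩; exact hy.1 (by omega)), add_zero] at hle
      exact rise_mono hle _
  rw [haw]
  norm_cast
  rw [div_mul_eq_mul_div, div_eq_inv_mul]
  exact mul_le_mul_right key _

/-! ### Expectation of the potential along the growth of the tree -/

theorem tsum_bind_mul {α β : Type*} (p : PMF α) (q : α → PMF β) (f : β → ℝ≥0∞) :
    ∑' b, p.bind q b * f b = ∑' a, p a * ∑' b, q a b * f b := by
  simp_rw [PMF.bind_apply, ← ENNReal.tsum_mul_right, ← ENNReal.tsum_mul_left, mul_assoc]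
  exact ENNReal.tsum_comm

theorem tsum_map_mul {α β : Type*} (p : PMF α) (u : α → β) (f : β → ℝ≥0∞) :
    ∑' b, p.map u b * f b = ∑' a, p a * f (u a) := by
  rw [PMF.map, tsum_bind_mul]
  refine tsum_congr fun a => ?_
  rw [tsum_eq_single (u a)]
  · simp
  · intro b hb
    simp [hb]

theorem tsum_paTreeLaw_succ (δ : ℝ≥0) (n : ℕ) (f : PATree (n + 1) → ℝ≥0∞) :
    ∑' e, paTreeLaw δ (n + 1) e * f e
      = ∑' e, paTreeLaw δ n e * ∑ i, attachWeight δ e i * f (e.extend i) := by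
  rw [paTreeLaw, tsum_bind_mul]
  refine tsum_congr fun e => ?_
  rw [tsum_map_mul, tsum_fintype]
  rfl

open Classical in
/-- The bound for the factor that the step from `l` to `l + 1` vertices contributes. -/
def stepFactor (δ : ℝ≥0) (F : Finset ℕ) (g : ℕ → ℕ) (l : ℕ) : ℝ≥0 :=
  if l ∈ F then (attachTotal δ l)⁻¹
  else 1 + (F.filter fun j => g j < l ∧ l < j).card / attachTotal δ l

open Classical in
theorem tsum_paTreeLaw_mul_potential_le (δ : ℝ≥0) (F : Finset ℕ) (g : ℕ → ℕ) (n : ℕ) :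
    ∑' e : PATree n, paTreeLaw δ n e *
        (if ∀ j : Fin n, (j : ℕ) ∈ F → (e j : ℕ) = g j then (potential δ F g e : ℝ≥0∞) else 0)
      ≤ ((∏ i ∈ F.image g, rise (2 + δ) (demand F g 0 i)) *
          ∏ l ∈ Finset.range n, stepFactor δ F g l : ℝ≥0) := by
  induction n with
  | zero =>
    have : ∀ e : PATree 0, potential δ F g e = ∏ i ∈ F.image g, rise (2 + δ) (demand F g 0 i) := by
      intro e
      simp [potential, vertexWeight]
    simp only [this, Finset.range_zero, Finset.prod_empty, mul_one, IsEmpty.forall_iff, if_true]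
    rw [ENNReal.tsum_mul_right, PMF.tsum_coe, one_mul]
  | succ n ih =>
    have hext : ∀ (e : PATree n) (i : Fin (n + 1)),
        (∀ j : Fin (n + 1), (j : ℕ) ∈ F → (e.extend i j : ℕ) = g j) ↔
          (∀ j : Fin n, (j : ℕ) ∈ F → (e j : ℕ) = g j) ∧ (n ∈ F → (i : ℕ) = g n) := by
      intro e i
      rw [Fin.forall_fin_succ']
      simp [PATree.extend]
    rw [tsum_paTreeLaw_succ]
    calc ∑' e : PATree n, paTreeLaw δ n e * ∑ i, attachWeight δ e i *
          (if ∀ j : Fin (n + 1), (j : ℕ) ∈ F → (e.extend i j : ℕ) = g j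
            then (potential δ F g (e.extend i) : ℝ≥0∞) else 0)
        ≤ ∑' e : PATree n, paTreeLaw δ n e * ((stepFactor δ F g n : ℝ≥0∞) *
          (if ∀ j : Fin n, (j : ℕ) ∈ F → (e j : ℕ) = g j
            then (potential δ F g e : ℝ≥0∞) else 0)) := by
          refine ENNReal.tsum_le_tsum fun e => mul_le_mul_right ?_ _
          simp only [hext]
          by_cases he : ∀ j : Fin n, (j : ℕ) ∈ F → (e j : ℕ) = g j
          swap
          · simp [he]
          have he' : (∀ j : Fin n, (j : ℕ) ∈ F → (e j : ℕ) = g j) = True := eq_true he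
          simp only [he', true_and, if_true]
          by_cases hn : n ∈ F
          · rw [stepFactor, if_pos hn]
            simp only [hn, true_imp_iff, mul_ite, mul_zero]
            -- If g n > n, the required edge is impossible and the sum vanishes.
            by_cases hi : ∃ i : Fin (n + 1), (i : ℕ) = g n
            · obtain ⟨i, hi⟩ := hi
              rw [Finset.sum_eq_single i]
              · rw [if_pos hi]
                exact attachWeight_mul_potential_le δ hn e hi
              · intro i' _ hne
                rw [if_neg]
                intro h
                exact hne (Fin.ext (h.trans hi.symm))
              · simp
            · rw [Finset.sum_eq_zero]
              · exact zero_le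
              · intro i _
                rw [if_neg fun h => hi ⟨i, h⟩]
          · rw [stepFactor, if_neg hn]
            simp only [hn, false_imp_iff, if_true]
            exact sum_attachWeight_mul_potential_le δ hn e
      _ = (stepFactor δ F g n : ℝ≥0∞) * ∑' e : PATree n, paTreeLaw δ n e *
          (if ∀ j : Fin n, (j : ℕ) ∈ F → (e j : ℕ) = g j
            then (potential δ F g e : ℝ≥0∞) else 0) := by
          rw [← ENNReal.tsum_mul_left]
          refine tsum_congr fun e => ?_
          ring
      _ ≤ _ := by
          refine (mul_le_mul_right ih _).trans (le_of_eq ?_)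
          rw [Finset.prod_range_succ]
          push_cast
          ring

/-- After N steps no demand is left and the potential is 1, so its mean over the event is the
probability itself. -/
theorem paTreeLaw_edges_le (δ : ℝ≥0) {F : Finset ℕ} {N : ℕ} (hF : F ⊆ Finset.range N) (g : ℕ → ℕ) :
    (paTreeLaw δ N).toMeasure {e | ∀ j : Fin N, (j : ℕ) ∈ F → (e j : ℕ) = g j}
      ≤ ((∏ i ∈ F.image g, rise (2 + δ) (demand F g 0 i)) *
          ∏ l ∈ Finset.range N, stepFactor δ F g l : ℝ≥0) := by
  classical
  refine le_trans (le_of_eq ?_) (tsum_paTreeLaw_mul_potential_le δ F g N)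
  rw [PMF.toMeasure_apply _ (Set.toFinite _).measurableSet]
  refine tsum_congr fun e => ?_
  have hpot : potential δ F g e = 1 := by
    refine Finset.prod_eq_one fun i _ => ?_
    have : demand F g N i = 0 := by
      rw [demand, Finset.card_eq_zero, Finset.filter_eq_empty_iff]
      rintro j hj ⟨h, -⟩
      have := Finset.mem_range.1 (hF hj)
      omega
    rw [this, rise_zero]
  rw [hpot, Set.indicator_apply]
  simp

/-! ### Estimating the bound -/

/-- Telescoping, since 1 + 1/(2l+1) ≤ √((l+1)/l), which amounts to 4l(l+1) ≤ (2l+1)². -/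
theorem prod_Ico_le_sqrt {a j : ℕ} (h : a + 1 ≤ j) :
    ∏ l ∈ Finset.Ico (a + 1) j, (1 + 1 / (2 * (l : ℝ) + 1)) ≤ √(j / (a + 1)) := by
  induction j, h using Nat.le_induction with
  | base =>
    push_cast
    rw [div_self (by positivity)]
    simp
  | succ j hj ih =>
    rw [Finset.prod_Ico_succ_top hj]
    have hj0 : (0 : ℝ) < j := by
      have : 0 < j := by omega
      exact_mod_cast this
    have h1 : 1 + 1 / (2 * (j : ℝ) + 1) ≤ √((j + 1) / j) := by
      refine Real.le_sqrt_of_sq_le ?_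
      rw [le_div_iff₀ hj0]
      field_simp
      ring_nf
      nlinarith
    calc _ ≤ √(j / (a + 1)) * √((j + 1) / j) := by gcongr
      _ = √((j + 1 : ℕ) / (a + 1)) := by
          rw [← Real.sqrt_mul (by positivity)]
          congr 1
          push_cast
          field_simp

theorem prod_Ioo_le_sqrt {a j : ℕ} (h : a ≤ j) :
    ∏ l ∈ Finset.Ioo a j, (1 + 1 / (2 * (l : ℝ) + 1)) ≤ √((j + 1) / (a + 1)) := by
  rcases h.eq_or_lt with rfl | h
  · rw [div_self (by positivity)]
    simp
  · refine (prod_Ico_le_sqrt (Nat.succ_le_of_lt h)).trans ?_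
    gcongr
    linarith

theorem prod_rise_le (δ : ℝ≥0) (F : Finset ℕ) (g : ℕ → ℕ) :
    ∏ i ∈ F.image g, rise (2 + δ) (demand F g 0 i) ≤ ((F.card + 1) * (1 + δ)) ^ F.card := by
  have hsum : F.card = ∑ i ∈ F.image g, demand F g 0 i := by
    rw [Finset.card_eq_sum_card_image g F]
    refine Finset.sum_congr rfl fun i _ => ?_
    simp [demand]
  calc ∏ i ∈ F.image g, rise (2 + δ) (demand F g 0 i)
      ≤ ∏ i ∈ F.image g, (((F.card : ℝ≥0) + 1) * (1 + δ)) ^ demand F g 0 i := by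
        refine Finset.prod_le_prod' fun i _ => ?_
        rw [rise]
        refine (Finset.prod_le_pow_card _ _ (((F.card : ℝ≥0) + 1) * (1 + δ)) fun l hl => ?_).trans (le_of_eq (by simp))
        have h1 : l + 1 ≤ F.card :=
          (Nat.succ_le_of_lt (Finset.mem_range.1 hl)).trans (Finset.card_filter_le _ _)
        have h2 : (l : ℝ≥0) + 1 ≤ F.card := by exact_mod_cast h1
        calc 2 + δ + (l : ℝ≥0) = (l + 1) + 1 + δ := by ring
          _ ≤ F.card + 1 + δ := by gcongr
          _ ≤ F.card + 1 + δ + F.card * δ := le_self_add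
          _ = _ := by ring
    _ = _ := by rw [Finset.prod_pow_eq_pow_sum, ← hsum]

/-- Bernoulli's inequality distributes a free step over the edges pending across l, so that each
edge can be estimated separately. -/
theorem stepFactor_le (δ : ℝ≥0) (F : Finset ℕ) (g : ℕ → ℕ) (l : ℕ) :
    (stepFactor δ F g l : ℝ) ≤ (if l ∈ F then ((1 + (δ : ℝ)) * (l + 1))⁻¹ else 1) *
      ∏ j ∈ F, if l ∈ Finset.Ioo (g j) j then (1 + 1 / (2 * (l : ℝ) + 1)) else 1 := by
  have hZ := attachTotal_pos δ l
  have hδ : (0 : ℝ) ≤ δ := δ.2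
  have hl : (0 : ℝ) ≤ l := Nat.cast_nonneg l
  have hZe : ((attachTotal δ l : ℝ≥0) : ℝ) = l * (2 + δ) + (1 + δ) := by
    simp [attachTotal]
  have hb : 0 ≤ 1 / (2 * (l : ℝ) + 1) := by positivity
  have hprod : ∏ j ∈ F, (if l ∈ Finset.Ioo (g j) j then (1 + 1 / (2 * (l : ℝ) + 1)) else 1)
      = (1 + 1 / (2 * (l : ℝ) + 1)) ^ (F.filter fun j => g j < l ∧ l < j).card := by
    rw [← Finset.prod_filter, Finset.prod_const]
    simp
  rw [hprod, stepFactor]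
  by_cases hl : l ∈ F
  · rw [if_pos hl, if_pos hl, NNReal.coe_inv, hZe]
    calc ((l : ℝ) * (2 + δ) + (1 + δ))⁻¹ ≤ ((1 + (δ : ℝ)) * (l + 1))⁻¹ := by
          gcongr
          nlinarith
      _ ≤ _ := le_mul_of_one_le_right (by positivity) (one_le_pow₀ (by linarith))
  · rw [if_neg hl, if_neg hl, one_mul]
    push_cast
    rw [hZe]
    refine le_trans ?_ (one_add_mul_le_pow (by linarith) _)
    have hle : 1 / ((l : ℝ) * (2 + δ) + (1 + δ)) ≤ 1 / (2 * (l : ℝ) + 1) :=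
      one_div_le_one_div_of_le (by positivity) (by nlinarith)
    rw [div_eq_mul_one_div]
    gcongr

/-- Each edge gains 1+δ from the initial potential and loses it again through the normalization at
its own step; this makes the bound uniform in δ. -/
theorem paTreeLaw_edges_le_prod (δ : ℝ≥0) {F : Finset ℕ} {N : ℕ} (hF : F ⊆ Finset.range N)
    {g : ℕ → ℕ} (hg : ∀ j ∈ F, g j ≤ j) :
    (paTreeLaw δ N).toMeasure.real {e | ∀ j : Fin N, (j : ℕ) ∈ F → (e j : ℕ) = g j}
      ≤ ∏ j ∈ F, ((F.card + 1) * ((√(j + 1))⁻¹ * (√(g j + 1))⁻¹)) := by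
  have hδ : (0 : ℝ) ≤ δ := δ.2
  have h1 := ENNReal.toReal_mono ENNReal.coe_ne_top (paTreeLaw_edges_le δ hF g)
  rw [measureReal_def]
  refine h1.trans ?_
  rw [ENNReal.coe_toReal, NNReal.coe_mul]
  have h2 : ((∏ i ∈ F.image g, rise (2 + δ) (demand F g 0 i) : ℝ≥0) : ℝ)
      ≤ ∏ _j ∈ F, (((F.card : ℝ) + 1) * (1 + δ)) := by
    rw [Finset.prod_const]
    exact_mod_cast prod_rise_le δ F g
  have h3 : ((∏ l ∈ Finset.range N, stepFactor δ F g l : ℝ≥0) : ℝ)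
      ≤ ∏ j ∈ F, (((1 + (δ : ℝ)) * (j + 1))⁻¹ * √((j + 1) / (g j + 1))) := by
    rw [NNReal.coe_prod]
    refine (Finset.prod_le_prod (fun _ _ => NNReal.coe_nonneg _)
      fun l _ => stepFactor_le δ F g l).trans ?_
    rw [Finset.prod_mul_distrib, Finset.prod_comm, Finset.prod_mul_distrib]
    have e1 : ∏ l ∈ Finset.range N, (if l ∈ F then ((1 + (δ : ℝ)) * (l + 1))⁻¹ else 1)
        = ∏ j ∈ F, ((1 + (δ : ℝ)) * (j + 1))⁻¹ := by
      rw [← Finset.prod_filter]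
      congr 1
      ext l
      simp only [Finset.mem_filter, and_iff_right_iff_imp]
      exact fun h => hF h
    rw [e1]
    refine mul_le_mul_of_nonneg_left ?_ (by positivity)
    refine Finset.prod_le_prod (fun j _ => Finset.prod_nonneg fun l _ => ?_) fun j hj => ?_
    · split_ifs <;> positivity
    · refine le_trans (le_of_eq ?_) (prod_Ioo_le_sqrt (hg j hj))
      rw [← Finset.prod_filter]
      congr 1
      ext l
      simp only [Finset.mem_filter, and_iff_right_iff_imp, Finset.mem_Ioo, Finset.mem_range]
      have := Finset.mem_range.1 (hF hj)
      omega
  refine (mul_le_mul h2 h3 (NNReal.coe_nonneg _) (by positivity)).trans (le_of_eq ?_)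
  rw [← Finset.prod_mul_distrib]
  refine Finset.prod_congr rfl fun j _ => ?_
  rw [Real.sqrt_div (by positivity)]
  have hs : √((j : ℝ) + 1) * √((j : ℝ) + 1) = j + 1 := Real.mul_self_sqrt (by positivity)
  have hs0 : 0 < √((j : ℝ) + 1) := Real.sqrt_pos.2 (by positivity)
  have hs1 : 0 < √((g j : ℝ) + 1) := Real.sqrt_pos.2 (by positivity)
  rw [show ((1 + (δ : ℝ)) * (j + 1))⁻¹ = ((1 + (δ : ℝ)) * (√((j : ℝ) + 1) * √((j : ℝ) + 1)))⁻¹ by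
    rw [hs]]
  field_simp

end Attachment

/-! ### Edge sets without leaves -/

namespace Multigraph

variable {V E : Type*} {G : Multigraph V E}

/-- Every vertex other than `v` that is incident with an edge in `F` has degree at least two in
the graph with edge set `F`. -/
def NoLeafExcept (G : Multigraph V E) (F : Finset E) (v : V) : Prop :=
  ∀ k : E × Bool, k.1 ∈ F → G.base k ≠ v → ∃ k' : E × Bool, k'.1 ∈ F ∧ G.base k' = G.base k ∧ k' ≠ k

theorem NoLeafExcept.union [DecidableEq E] {F F' : Finset E} {v : V} (h : G.NoLeafExcept F v)
    (h' : G.NoLeafExcept F' v) : G.NoLeafExcept (F ∪ F') v := by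
  intro k hk hv
  rcases Finset.mem_union.1 hk with hk | hk
  · obtain ⟨k', h1, h2⟩ := h k hk hv
    exact ⟨k', Finset.mem_union_left _ h1, h2⟩
  · obtain ⟨k', h1, h2⟩ := h' k hk hv
    exact ⟨k', Finset.mem_union_right _ h1, h2⟩

theorem eq_or_eq_rev_of_fst_eq {h k : E × Bool} (he : k.1 = h.1) : k = h ∨ k = rev h := by
  rcases h with ⟨e, b⟩
  rcases k with ⟨e', b'⟩
  obtain rfl : e' = e := he
  cases b <;> cases b' <;> simp [rev]

theorem NBWalk.start_mem {h : E × Bool} {l : List (E × Bool)} (hw : G.NBWalk h l) : h ∈ l := by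
  induction hw with
  | single => simp
  | cons _ _ ih => exact List.mem_cons_of_mem _ ih

/-- Where the walk passes through a vertex, it leaves by a half-edge other than the one it arrived
on. Only its two extremities can lack a partner. -/
theorem NBWalk.exists_partner {h g : E × Bool} {l : List (E × Bool)} (hw : G.NBWalk h (g :: l))
    {k : E × Bool} (hk : k.1 ∈ (g :: l).map Prod.fst) (hb : G.base k ≠ G.base h) (hg : k ≠ rev g) :
    ∃ k' : E × Bool, k'.1 ∈ (g :: l).map Prod.fst ∧ G.base k' = G.base k ∧ k' ≠ k := by
  generalize hL : g :: l = L at hw hk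
  induction hw generalizing g l with
  | single =>
    obtain ⟨rfl, rfl⟩ := List.cons.inj hL
    rcases eq_or_eq_rev_of_fst_eq (by simpa using hk) with rfl | rfl
    · exact absurd rfl hb
    · exact absurd rfl hg
  | @cons g₁ g₂ l₁ hw hf ih =>
    obtain ⟨rfl, rfl⟩ := List.cons.inj hL
    by_cases hk' : k.1 ∈ (g₁ :: l₁).map Prod.fst
    · by_cases hkg : k = rev g₁
      · refine ⟨g, by simp, ?_, ?_⟩
        · rw [hkg, base_rev, hf.1]
        · rw [hkg]
          exact hf.2
      · obtain ⟨k', h1, h2⟩ := ih hkg rfl hk'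
        exact ⟨k', by rw [List.map_cons]; exact List.mem_cons_of_mem _ h1, h2⟩
    · have hkg : k.1 = g.1 := by
        rw [List.map_cons, List.mem_cons] at hk
        exact hk.resolve_right hk'
      rcases eq_or_eq_rev_of_fst_eq hkg with rfl | rfl
      · exact ⟨rev g₁, by simp, by rw [base_rev, hf.1], hf.2.symm⟩
      · exact absurd rfl hg

theorem card_toFinset_map_fst_le [DecidableEq E] (l : List (E × Bool)) :
    (l.map Prod.fst).toFinset.card ≤ l.length :=
  (List.toFinset_card_le _).trans (by simp)

theorem NBWalk.start_mem_edges [DecidableEq E] {h : E × Bool} {l : List (E × Bool)}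
    (hw : G.NBWalk h l) : h.1 ∈ (l.map Prod.fst).toFinset :=
  List.mem_toFinset.2 (List.mem_map_of_mem hw.start_mem)

theorem NBWalk.noLeafExcept_of_closed [DecidableEq E] {h g : E × Bool} {l : List (E × Bool)}
    (hw : G.NBWalk h (g :: l)) (ht : G.tip g = G.base h) :
    G.NoLeafExcept ((g :: l).map Prod.fst).toFinset (G.base h) := by
  intro k hk hb
  rw [List.mem_toFinset] at hk
  obtain ⟨k', h1, h2⟩ := hw.exists_partner hk hb (by rintro rfl; exact hb (by simpa using ht))
  exact ⟨k', List.mem_toFinset.2 h1, h2⟩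

theorem NBWalk.noLeafExcept_union [DecidableEq E] {h g g' : E × Bool} {l l' : List (E × Bool)}
    (hw : G.NBWalk h (g :: l)) (hw' : G.NBWalk h (g' :: l')) (ht : G.tip g = G.tip g')
    (hne : g ≠ g') :
    G.NoLeafExcept (((g :: l).map Prod.fst).toFinset ∪ ((g' :: l').map Prod.fst).toFinset)
      (G.base h) := by
  intro k hk hb
  have hrev : ∀ {x y : E × Bool}, x ≠ y → rev x ≠ rev y := fun h h' => h (rev_injective h')
  simp only [Finset.mem_union, List.mem_toFinset] at hk ⊢
  rcases hk with hk | hk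
  · by_cases hkg : k = rev g
    · subst hkg
      exact ⟨rev g', Or.inr (by simp), by simp [ht], hrev hne.symm⟩
    · obtain ⟨k', h1, h2⟩ := hw.exists_partner hk hb hkg
      exact ⟨k', Or.inl h1, h2⟩
  · by_cases hkg : k = rev g'
    · subst hkg
      exact ⟨rev g, Or.inl (by simp), by simp [ht], hrev hne⟩
    · obtain ⟨k', h1, h2⟩ := hw'.exists_partner hk hb hkg
      exact ⟨k', Or.inr h1, h2⟩

/-- Strip common final steps. Either the final steps come to differ, and then each is the other's
partner at the common end; or one walk shrinks to its first step, and the other, without its last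
step, returns to the base of h. -/
theorem exists_noLeafExcept_of_walks [DecidableEq E] {h g g' : E × Bool} {l l' : List (E × Bool)}
    (hw : G.NBWalk h (g :: l)) (hw' : G.NBWalk h (g' :: l')) (ht : G.tip g = G.tip g')
    (hne : g :: l ≠ g' :: l') :
    ∃ F : Finset E, F.card ≤ (l.length + 1) + (l'.length + 1) ∧ h.1 ∈ F ∧
      G.NoLeafExcept F (G.base h) := by
  induction l generalizing g g' l' with
  | nil =>
    by_cases hg : g = g'
    · subst hg
      have hgh : g = h := by cases hw; rfl
      subst hgh
      cases hw' with
      | single => exact absurd rfl hne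
      | cons hw₂ hf =>
        refine ⟨_, (card_toFinset_map_fst_le _).trans ?_, hw₂.start_mem_edges,
          hw₂.noLeafExcept_of_closed hf.1.symm⟩
        simp only [List.length_cons]
        omega
    · exact ⟨_, (Finset.card_union_le _ _).trans
        (add_le_add (card_toFinset_map_fst_le _) (card_toFinset_map_fst_le _)),
        Finset.mem_union_left _ hw.start_mem_edges, hw.noLeafExcept_union hw' ht hg⟩
  | cons g₁ l₁ ih =>
    by_cases hg : g = g'
    · subst hg
      cases hw with
      | cons hw₁ hf =>
        cases hw' with
        | single =>
          refine ⟨_, (card_toFinset_map_fst_le _).trans ?_, hw₁.start_mem_edges,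
            hw₁.noLeafExcept_of_closed hf.1.symm⟩
          simp only [List.length_cons]
          omega
        | cons hw₂ hf₂ =>
          obtain ⟨F, h1, h2⟩ := ih hw₁ hw₂ (hf.1.symm.trans hf₂.1) (fun h => hne (by rw [h]))
          refine ⟨F, h1.trans ?_, h2⟩
          simp only [List.length_cons]
          omega
    · exact ⟨_, (Finset.card_union_le _ _).trans
        (add_le_add (card_toFinset_map_fst_le _) (card_toFinset_map_fst_le _)),
        Finset.mem_union_left _ hw.start_mem_edges, hw.noLeafExcept_union hw' ht hg⟩

theorem exists_noLeafExcept_of_not_clean [DecidableEq E] {L : ℕ} {h : E × Bool}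
    (hc : ¬ G.Clean L h) :
    ∃ F : Finset E, F.card ≤ 2 * L ∧ h.1 ∈ F ∧ G.NoLeafExcept F (G.base h) := by
  unfold Clean at hc
  push Not at hc
  obtain ⟨g, g', l, l', hw, hw', hl, hl', ht, hne⟩ := hc
  obtain ⟨F, h1, h2⟩ := exists_noLeafExcept_of_walks hw hw' ht hne
  exact ⟨F, by omega, h2⟩

/-- There is a set of at most `M` edges that has no leaves and at least three half-edges
at `v`. -/
def HasExcess (G : Multigraph V E) (M : ℕ) (v : V) : Prop :=
  ∃ F : Finset E, F.card ≤ M ∧ G.NoLeafExcept F v ∧ ∃ a b c : E × Bool,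
    a ≠ b ∧ a ≠ c ∧ b ≠ c ∧ (a.1 ∈ F ∧ G.base a = v) ∧ (b.1 ∈ F ∧ G.base b = v) ∧
      (c.1 ∈ F ∧ G.base c = v)

open Classical in
theorem card_not_clean_le_two [Fintype E] [DecidableEq V] {L : ℕ} {v : V} (hv : ¬ G.HasExcess (6 * L) v) :
    ((G.halfEdgesAt v).filter fun h => ¬ G.Clean L h).card ≤ 2 := by
  by_contra! hlt
  obtain ⟨a, ha, b, hb, c, hc, hab, hac, hbc⟩ := Finset.two_lt_card.1 hlt
  simp only [Finset.mem_filter, halfEdgesAt, Finset.mem_univ, true_and] at ha hb hc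
  obtain ⟨Fa, a1, a2, a3⟩ := exists_noLeafExcept_of_not_clean ha.2
  obtain ⟨Fb, b1, b2, b3⟩ := exists_noLeafExcept_of_not_clean hb.2
  obtain ⟨Fc, c1, c2, c3⟩ := exists_noLeafExcept_of_not_clean hc.2
  rw [ha.1] at a3
  rw [hb.1] at b3
  rw [hc.1] at c3
  refine hv ⟨Fa ∪ Fb ∪ Fc, ?_, (a3.union b3).union c3, a, b, c, hab, hac, hbc,
    ⟨by simp [a2], ha.1⟩, ⟨by simp [b2], hb.1⟩, ⟨by simp [c2], hc.1⟩⟩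
  have h1 := Finset.card_union_le (Fa ∪ Fb) Fc
  have h2 := Finset.card_union_le Fa Fb
  omega

end Multigraph

/-! ### Counting edge sets without leaves -/

/-- Choose the entries one by one: an entry with a new image x pays w x, one with an image already
used pays 1, and there are at most N images. -/
theorem sum_prod_image_fin_le {α β : Type*} [Fintype α] [Fintype β] [DecidableEq β] (f : α → β)
    (c : ℕ) (hf : ∀ u : β → ℝ, ∑ a, u (f a) = c * ∑ x, u x) {w : β → ℝ} (hw : ∀ x, 0 ≤ w x)
    (N : ℕ) :
    ∑ z : Fin N → α, ∏ x ∈ Finset.univ.image (f ∘ z), w x ≤ (c * (∑ x, w x + N)) ^ N := by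
  have hW : 0 ≤ ∑ x, w x := Finset.sum_nonneg fun x _ => hw x
  induction N with
  | zero => simp
  | succ N ih =>
    rw [← (Fin.consEquiv fun _ : Fin (N + 1) => α).sum_comp, Fintype.sum_prod_type_right]
    have himg : ∀ (z : Fin N → α) (a : α),
        Finset.univ.image (f ∘ (Fin.consEquiv fun _ : Fin (N + 1) => α) (a, z))
          = insert (f a) (Finset.univ.image (f ∘ z)) := by
      intro z a
      ext x
      simp only [Finset.mem_image, Finset.mem_univ, true_and, Finset.mem_insert,
        Function.comp_apply, Fin.consEquiv_apply, Fin.exists_fin_succ, Fin.cons_zero, Fin.cons_succ]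
      exact or_congr_left eq_comm
    have hinner : ∀ z : Fin N → α, ∑ a, ∏ x ∈ Finset.univ.image
        (f ∘ (Fin.consEquiv fun _ : Fin (N + 1) => α) (a, z)), w x
          ≤ (∏ x ∈ Finset.univ.image (f ∘ z), w x) * (c * (∑ x, w x + (N + 1 : ℕ))) := by
      intro z
      set S := Finset.univ.image (f ∘ z) with hS
      have hP : 0 ≤ ∏ x ∈ S, w x := Finset.prod_nonneg fun x _ => hw x
      calc ∑ a, ∏ x ∈ Finset.univ.image
            (f ∘ (Fin.consEquiv fun _ : Fin (N + 1) => α) (a, z)), w x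
          ≤ ∑ a, (∏ x ∈ S, w x) * (w (f a) + if f a ∈ S then 1 else 0) := by
            refine Finset.sum_le_sum fun a _ => ?_
            rw [himg, ← hS]
            have := hw (f a)
            by_cases ha : f a ∈ S
            · rw [Finset.insert_eq_of_mem ha, if_pos ha]
              nlinarith
            · rw [Finset.prod_insert ha, if_neg ha]
              nlinarith
        _ = (∏ x ∈ S, w x) * (c * (∑ x, w x + S.card)) := by
            rw [← Finset.mul_sum, hf fun x => w x + if x ∈ S then 1 else 0,
              Finset.sum_add_distrib]
            simp
        _ ≤ _ := by
            have : S.card ≤ N + 1 := Finset.card_image_le.trans (by simp)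
            gcongr
    refine (Finset.sum_le_sum fun z _ => hinner z).trans ?_
    rw [← Finset.sum_mul, pow_succ]
    gcongr
    refine ih.trans ?_
    gcongr
    simp

theorem sum_prod_image_le {ι α β : Type*} [Fintype ι] [DecidableEq ι] [Fintype α] [Fintype β]
    [DecidableEq β] (f : α → β)
    (c : ℕ) (hf : ∀ u : β → ℝ, ∑ a, u (f a) = c * ∑ x, u x) {w : β → ℝ} (hw : ∀ x, 0 ≤ w x) :
    ∑ z : ι → α, ∏ x ∈ Finset.univ.image (f ∘ z), w x
      ≤ (c * (∑ x, w x + Fintype.card ι)) ^ Fintype.card ι := by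
  refine le_trans (le_of_eq ?_) (sum_prod_image_fin_le f c hf hw (Fintype.card ι))
  refine Fintype.sum_equiv ((Fintype.equivFin ι).arrowCongr (Equiv.refl α)) _ _ fun z => ?_
  congr 1
  ext x
  simp only [Finset.mem_image, Finset.mem_univ, true_and, Function.comp_apply,
    Equiv.arrowCongr_apply, Equiv.coe_refl, id]
  exact (Fintype.equivFin ι).symm.surjective.exists

theorem sum_divNat {t m : ℕ} (u : Fin t → ℝ) :
    ∑ a : Fin (t * m), u a.divNat = m * ∑ x, u x := by
  rw [← finProdFinEquiv.sum_comp, Fintype.sum_prod_type, Finset.mul_sum]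
  refine Finset.sum_congr rfl fun x _ => ?_
  have : ∀ y : Fin m, (finProdFinEquiv (x, y)).divNat = x := fun y =>
    congrArg Prod.fst (finProdFinEquiv.symm_apply_apply (x, y))
  simp [this]

/-- The ends `z` of a sequence of edges form a configuration without leaves, with a vertex of
number at least `κ` of degree at least three. -/
def ExcessPattern {t m r : ℕ} (κ : ℝ) (z : Fin r × Bool → Fin (t * m)) : Prop :=
  Function.Injective (fun s => z (s, false)) ∧ (∀ s, z (s, true) ≤ z (s, false)) ∧
    ∃ v : Fin t, κ < (v : ℕ) + 1 ∧
      (∀ q, (z q).divNat ≠ v → ∃ q', (z q').divNat = (z q).divNat ∧ q' ≠ q) ∧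
      ∃ a b c, a ≠ b ∧ a ≠ c ∧ b ≠ c ∧ (z a).divNat = v ∧ (z b).divNat = v ∧ (z c).divNat = v

/-- Group the half-edges by contracted vertex, whose index is at most that of the tree vertex. Two
half-edges at x give 1/x; the third one at v gives the extra κ^(-1/2). -/
theorem ExcessPattern.prod_le {t m r : ℕ} {κ : ℝ} (hκ : 0 < κ) {z : Fin r × Bool → Fin (t * m)}
    (hz : ExcessPattern κ z) :
    ∏ q, (√((z q : ℕ) + 1))⁻¹ ≤
      (√κ)⁻¹ * ∏ x ∈ Finset.univ.image (Fin.divNat ∘ z), (((x : ℕ) : ℝ) + 1)⁻¹ := by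
  obtain ⟨-, -, v, hv, hleaf, a, b, c, hab, hac, hbc, ha, hb, hc⟩ := hz
  set f : Fin t → ℝ := fun x => (√(((x : ℕ) : ℝ) + 1))⁻¹ with hf
  have hf0 : ∀ x, 0 ≤ f x := fun x => by positivity
  have hf1 : ∀ x, f x ≤ 1 := fun x => inv_le_one_of_one_le₀ (Real.one_le_sqrt.2 (by simp))
  have hf2 : ∀ x : Fin t, f x ^ 2 = (((x : ℕ) : ℝ) + 1)⁻¹ := fun x => by
    rw [hf, inv_pow, Real.sq_sqrt (by positivity)]
  have h1 : ∏ q, (√((z q : ℕ) + 1))⁻¹ ≤ ∏ q, f ((Fin.divNat ∘ z) q) := by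
    refine Finset.prod_le_prod (fun q _ => by positivity) fun q _ => ?_
    have : ((z q).divNat : ℕ) ≤ (z q : ℕ) :=
      Nat.div_le_self _ _
    simp only [hf, Function.comp_apply]
    gcongr
  refine h1.trans ?_
  rw [Finset.prod_comp f (Fin.divNat ∘ z)]
  have hterm : ∀ x ∈ Finset.univ.image (Fin.divNat ∘ z),
      f x ^ (Finset.univ.filter fun q => (Fin.divNat ∘ z) q = x).card
        ≤ (((x : ℕ) : ℝ) + 1)⁻¹ * if x = v then (√κ)⁻¹ else 1 := by
    intro x hx
    obtain ⟨q, -, rfl⟩ := Finset.mem_image.1 hx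
    by_cases hxv : (z q).divNat = v
    · simp only [Function.comp_apply, hxv, if_true]
      have h3 : 3 ≤ (Finset.univ.filter fun q => (z q).divNat = v).card := by
        have : 2 < (Finset.univ.filter fun q => (z q).divNat = v).card :=
          Finset.two_lt_card.2 ⟨a, by simp [ha], b, by simp [hb], c, by simp [hc], hab, hac, hbc⟩
        omega
      refine (pow_le_pow_of_le_one (hf0 v) (hf1 v) h3).trans ?_
      rw [pow_succ, hf2]
      simp only [hf]
      gcongr
    · simp only [Function.comp_apply]
      rw [if_neg hxv, mul_one, ← hf2]
      refine pow_le_pow_of_le_one (hf0 _) (hf1 _) ?_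
      obtain ⟨q', hq', hne⟩ := hleaf q hxv
      have : 1 < (Finset.univ.filter fun p => (z p).divNat = (z q).divNat).card :=
        Finset.one_lt_card.2 ⟨q, by simp, q', by simp [hq'], hne.symm⟩
      omega
  refine (Finset.prod_le_prod (fun x _ => pow_nonneg (hf0 x) _) hterm).trans (le_of_eq ?_)
  rw [Finset.prod_mul_distrib, Finset.prod_ite_eq', if_pos, mul_comm]
  exact Finset.mem_image.2 ⟨a, Finset.mem_univ _, ha⟩

theorem measureReal_edges_le {N r : ℕ} (δ : ℝ≥0) {z : Fin r × Bool → Fin N}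
    (hinj : Function.Injective fun s => z (s, false)) (hle : ∀ s, z (s, true) ≤ z (s, false)) :
    (paTreeLaw δ N).toMeasure.real
        {e | ∀ s, ((e (z (s, false)) : ℕ)) = z (s, true)}
      ≤ (r + 1) ^ r * ∏ q, (√((z q : ℕ) + 1))⁻¹ := by
  set J : Fin r → ℕ := fun s => (z (s, false) : ℕ) with hJ
  have hJinj : Function.Injective J := fun s s' h => hinj (Fin.ext h)
  -- Only the values of g on the range of J matter.
  set g : ℕ → ℕ := Function.extend J (fun s => (z (s, true) : ℕ)) id with hg
  have hgJ : ∀ s, g (J s) = (z (s, true) : ℕ) := fun s => hJinj.extend_apply _ _ s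
  set F : Finset ℕ := Finset.univ.image J with hF
  have hcard : F.card = r := by
    rw [hF, Finset.card_image_of_injective _ hJinj, Finset.card_univ, Fintype.card_fin]
  have hFN : F ⊆ Finset.range N := by
    intro j hj
    obtain ⟨s, -, rfl⟩ := Finset.mem_image.1 hj
    exact Finset.mem_range.2 (z (s, false)).isLt
  have hgF : ∀ j ∈ F, g j ≤ j := by
    intro j hj
    obtain ⟨s, -, rfl⟩ := Finset.mem_image.1 hj
    rw [hgJ]
    exact hle s
  have key := paTreeLaw_edges_le_prod δ hFN hgF
  rw [hcard, hF, Finset.prod_image fun s _ s' _ h => hJinj h] at key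
  refine (measureReal_mono ?_).trans (key.trans (le_of_eq ?_))
  · intro e he j hj
    obtain ⟨s, -, hs⟩ := Finset.mem_image.1 hj
    obtain rfl : z (s, false) = j := Fin.ext hs
    exact (he s).trans (hgJ s).symm
  · rw [Finset.prod_mul_distrib, Finset.prod_const, Fintype.prod_prod_type]
    simp only [Fintype.prod_bool, hgJ, Finset.card_univ, Fintype.card_fin]
    congr 1
    exact Finset.prod_congr rfl fun s _ => mul_comm _ _

theorem exists_excessPattern {t m M : ℕ} {κ : ℝ} {e : PATree (t * m)} {v : Fin t}
    (hv : κ < (v : ℕ) + 1) (hex : (paGraph e).HasExcess M v) :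
    ∃ r ≤ M, ∃ z : Fin r × Bool → Fin (t * m), ExcessPattern κ z ∧
      ∀ s, ((e (z (s, false)) : ℕ)) = z (s, true) := by
  obtain ⟨F, hF, hleaf, a, b, c, hab, hac, hbc, ha, hb, hc⟩ := hex
  set φ : Fin F.card ≃ F := F.equivFin.symm with hφ
  set z : Fin F.card × Bool → Fin (t * m) := fun q =>
    if q.2 then Fin.castLE (φ q.1 : Fin (t * m)).isLt (e (φ q.1)) else φ q.1 with hz
  have hbase : ∀ (s : Fin F.card) (β : Bool), (paGraph e).base (φ s, β) = (z (s, β)).divNat := by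
    intro s β
    cases β <;> rfl
  have hlift : ∀ k : Fin (t * m) × Bool, k.1 ∈ F → ∃ s, k = ((φ s : Fin (t * m)), k.2) := by
    intro k hk
    exact ⟨φ.symm ⟨k.1, hk⟩, by simp⟩
  refine ⟨F.card, hF, z, ⟨?_, ?_, v, hv, ?_, ?_⟩, ?_⟩
  · intro s s' h
    exact φ.injective (Subtype.ext h)
  · intro s
    rw [Fin.le_iff_val_le_val]
    exact Nat.le_of_lt_succ (e (φ s)).isLt
  · rintro ⟨s, β⟩ hq
    rw [← hbase] at hq
    obtain ⟨k', h1, h2, h3⟩ := hleaf (φ s, β) (φ s).2 hq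
    obtain ⟨s', hs'⟩ := hlift k' h1
    refine ⟨(s', k'.2), ?_, ?_⟩
    · rw [← hbase, ← hbase, ← hs', h2]
    · rintro h
      obtain ⟨rfl, h'⟩ := Prod.mk.inj h
      exact h3 (by rw [hs', h'])
  · obtain ⟨sa, hsa⟩ := hlift a ha.1
    obtain ⟨sb, hsb⟩ := hlift b hb.1
    obtain ⟨sc, hsc⟩ := hlift c hc.1
    refine ⟨(sa, a.2), (sb, b.2), (sc, c.2), ?_, ?_, ?_, ?_, ?_, ?_⟩
    · intro h
      obtain ⟨h1, h2⟩ := Prod.mk.inj h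
      exact hab (by rw [hsa, hsb, h1, h2])
    · intro h
      obtain ⟨h1, h2⟩ := Prod.mk.inj h
      exact hac (by rw [hsa, hsc, h1, h2])
    · intro h
      obtain ⟨h1, h2⟩ := Prod.mk.inj h
      exact hbc (by rw [hsb, hsc, h1, h2])
    · rw [← hbase, ← hsa, ha.2]
    · rw [← hbase, ← hsb, hb.2]
    · rw [← hbase, ← hsc, hc.2]
  · intro s
    rfl

/-- First moment over all patterns with r ≤ M labelled edges. A contracted vertex comes from m tree
vertices, whence the factor m. -/
theorem measureReal_hasExcess_le (δ : ℝ≥0) (t m M : ℕ) {κ : ℝ} (hκ : 0 < κ) :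
    (paTreeLaw δ (t * m)).toMeasure.real
        {e | ∃ v : Fin t, κ < (v : ℕ) + 1 ∧ (paGraph e).HasExcess M v}
      ≤ ∑ r ∈ Finset.range (M + 1), (r + 1) ^ r * ((√κ)⁻¹ *
          (m * (∑ x : Fin t, (((x : ℕ) : ℝ) + 1)⁻¹ + (2 * r : ℕ))) ^ (2 * r)) := by
  classical
  set P := (paTreeLaw δ (t * m)).toMeasure with hP
  have hcover : {e : PATree (t * m) | ∃ v : Fin t, κ < (v : ℕ) + 1 ∧ (paGraph e).HasExcess M v}
      ⊆ ⋃ r ∈ Finset.range (M + 1),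
        ⋃ z ∈ Finset.univ.filter fun z : Fin r × Bool → Fin (t * m) => ExcessPattern κ z,
          {e | ∀ s, ((e (z (s, false)) : ℕ)) = z (s, true)} := by
    rintro e ⟨v, hv, hex⟩
    obtain ⟨r, hr, z, hz, hez⟩ := exists_excessPattern hv hex
    simp only [Set.mem_iUnion, Finset.mem_range, Finset.mem_filter, Finset.mem_univ, true_and]
    exact ⟨r, by omega, z, hz, hez⟩
  refine (measureReal_mono hcover (measure_ne_top _ _)).trans ?_
  refine (measureReal_biUnion_finset_le _ _).trans (Finset.sum_le_sum fun r _ => ?_)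
  refine (measureReal_biUnion_finset_le _ _).trans ?_
  have hcount := sum_prod_image_le (ι := Fin r × Bool) (Fin.divNat : Fin (t * m) → Fin t) m
    sum_divNat (w := fun x => (((x : ℕ) : ℝ) + 1)⁻¹) (fun x => by positivity)
  have hcard : Fintype.card (Fin r × Bool) = 2 * r := by simp [mul_comm]
  rw [hcard] at hcount
  calc ∑ z ∈ Finset.univ.filter fun z : Fin r × Bool → Fin (t * m) => ExcessPattern κ z,
        P.real {e | ∀ s, ((e (z (s, false)) : ℕ)) = z (s, true)}
      ≤ ∑ z ∈ Finset.univ.filter fun z : Fin r × Bool → Fin (t * m) => ExcessPattern κ z,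
        ((r : ℝ) + 1) ^ r * ((√κ)⁻¹ *
          ∏ x ∈ Finset.univ.image (Fin.divNat ∘ z), (((x : ℕ) : ℝ) + 1)⁻¹) := by
        refine Finset.sum_le_sum fun z hz => ?_
        have hz' := (Finset.mem_filter.1 hz).2
        refine (measureReal_edges_le δ hz'.1 hz'.2.1).trans ?_
        gcongr
        exact hz'.prod_le hκ
    _ ≤ ∑ z : Fin r × Bool → Fin (t * m), ((r : ℝ) + 1) ^ r * ((√κ)⁻¹ *
          ∏ x ∈ Finset.univ.image (Fin.divNat ∘ z), (((x : ℕ) : ℝ) + 1)⁻¹) := by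
        refine Finset.sum_le_univ_sum_of_nonneg fun z => ?_
        have : 0 ≤ ∏ x ∈ Finset.univ.image (Fin.divNat ∘ z), (((x : ℕ) : ℝ) + 1)⁻¹ :=
          Finset.prod_nonneg fun x _ => by positivity
        positivity
    _ ≤ _ := by
        rw [← Finset.mul_sum, ← Finset.mul_sum]
        gcongr

/-! ### Blue vertices on a given graph -/

section Blue

theorem measurableSet_exists_guardedColour {V E : Type*} [Fintype E]
    (G : Multigraph V E) (L : ℕ) (S : Finset ℕ) :
    MeasurableSet {ω : (V → Bool) × (ℕ × V → Finset (E × Bool)) |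
      ∃ s ∈ S, ∃ h₀, G.Clean L h₀ ∧ guardedColour G ω.1 ω.2 s h₀ = true} := by
  have hset : {ω : (V → Bool) × (ℕ × V → Finset (E × Bool)) |
      ∃ s ∈ S, ∃ h₀, G.Clean L h₀ ∧ guardedColour G ω.1 ω.2 s h₀ = true}
      = ⋃ s ∈ S, ⋃ h₀ ∈ {h₀ | G.Clean L h₀}, {ω | guardedColour G ω.1 ω.2 s h₀ = true} := by
    ext ω
    simp
  rw [hset]
  exact Finset.measurableSet_biUnion _ fun s _ => MeasurableSet.biUnion (Set.to_countable _)
    fun h₀ _ => (determined_guardedColour G s h₀).measurableSet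

variable {V E : Type*} [Fintype E] [DecidableEq V]

/-- Red votes come only from unclean half-edges, of which there are at most two, less than half of a
poll of five or more. -/
theorem colour_succ_eq_false {G : Multigraph V E} {X₀ : V → Bool}
    {N : ℕ × V → Finset (E × Bool)} {k L T : ℕ} {v : V} (hv : ¬ G.HasExcess (6 * L) v)
    (hN : N (T + 1, v) ∈ (G.halfEdgesAt v).powersetCard (pollSize G k v))
    (h5 : 5 ≤ pollSize G k v)
    (hclean : ∀ h, G.Clean L h → ¬ guardedColour G X₀ N T h = true) :
    colour G X₀ N (T + 1) v = false := by
  classical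
  rw [Finset.mem_powersetCard] at hN
  have hsub : ((N (T + 1, v)).filter fun h => colour G X₀ N T (G.tip h) = true)
      ⊆ (G.halfEdgesAt v).filter fun h => ¬ G.Clean L h := by
    intro h hh
    rw [Finset.mem_filter] at hh ⊢
    exact ⟨hN.1 hh.1, fun hc => hclean h hc (guardedColour_of_colour hh.2)⟩
  have h1 := (Finset.card_le_card hsub).trans (card_not_clean_le_two hv)
  simp only [colour, decide_eq_false_iff_not, not_lt]
  omega

variable [Fintype V]

theorem measure_poll_notMem (G : Multigraph V E) (k : ℕ) (α : unitInterval) :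
    protocolLaw G k α {ω | ∃ p : ℕ × V,
      ω.2 p ∉ (G.halfEdgesAt p.2).powersetCard (pollSize G k p.2)} = 0 := by
  have hset : {ω : (V → Bool) × (ℕ × V → Finset (E × Bool)) | ∃ p : ℕ × V,
      ω.2 p ∉ (G.halfEdgesAt p.2).powersetCard (pollSize G k p.2)}
      = ⋃ p : ℕ × V, ⋃ Q ∈ {Q | Q ∉ (G.halfEdgesAt p.2).powersetCard (pollSize G k p.2)},
        {ω | ω.2 p = Q} := by
    ext ω
    simp
  rw [hset, measure_iUnion_null_iff]
  intro p
  rw [measure_biUnion_null_iff (Set.to_countable _)]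
  intro Q hQ
  have h := measureReal_poll_eq G k α p Q
  rwa [pollLaw_eq_zero G k p.2 hQ, ENNReal.toReal_zero, measureReal_eq_zero_iff] at h

theorem measureReal_exists_guardedColour_le {G : Multigraph V E} {k h L a : ℕ}
    {α : unitInterval} (hh : 2 ≤ h) (hα : (α : ℝ) < alphaStar (2 * h + 1))
    (hpoll : ∀ v, ∃ i, h ≤ i ∧ pollSize G k v = 2 * i + 1) {S : Finset ℕ}
    (hS : ∀ s ∈ S, a ≤ s ∧ s + 1 ≤ L) :
    (protocolLaw G k α).real
        {ω | ∃ s ∈ S, ∃ h₀, G.Clean L h₀ ∧ guardedColour G ω.1 ω.2 s h₀ = true}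
      ≤ S.card * (2 * Fintype.card E) * redSeq h α a := by
  classical
  have hset : {ω : (V → Bool) × (ℕ × V → Finset (E × Bool)) |
      ∃ s ∈ S, ∃ h₀, G.Clean L h₀ ∧ guardedColour G ω.1 ω.2 s h₀ = true}
      ⊆ ⋃ q ∈ S ×ˢ (Finset.univ.filter fun h₀ => G.Clean L h₀),
        {ω | guardedColour G ω.1 ω.2 q.1 q.2 = true} := by
    rintro ω ⟨s, hs, h₀, hc, hg⟩
    simp only [Set.mem_iUnion, Finset.mem_product, Finset.mem_filter, Finset.mem_univ, true_and]
    exact ⟨(s, h₀), ⟨hs, hc⟩, hg⟩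
  refine (measureReal_mono hset (measure_ne_top _ _)).trans ?_
  refine (measureReal_biUnion_finset_le _ _).trans ?_
  have hr0 : 0 ≤ redSeq h α a := (redSeq_mem hh α.2.1 hα a).1
  refine (Finset.sum_le_card_nsmul _ _ (redSeq h α a) ?_).trans ?_
  · rintro ⟨s, h₀⟩ hq
    simp only [Finset.mem_product, Finset.mem_filter, Finset.mem_univ, true_and] at hq
    obtain ⟨h1, h2⟩ := hS s hq.1
    exact (measureReal_guardedColour_le hh hα hpoll s (hq.2.mono h2)).trans
      (redSeq_antitone hh α.2.1 hα h1)
  · rw [nsmul_eq_mul, Finset.card_product]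
    push_cast
    gcongr
    have : (Finset.univ.filter fun h₀ : E × Bool => G.Clean L h₀).card ≤ 2 * Fintype.card E :=
      (Finset.card_filter_le _ _).trans (by simp [mul_comm])
    exact_mod_cast this

theorem measurableSet_exists_poll_notMem (G : Multigraph V E) (k : ℕ) :
    MeasurableSet {ω : (V → Bool) × (ℕ × V → Finset (E × Bool)) | ∃ p : ℕ × V,
      ω.2 p ∉ (G.halfEdgesAt p.2).powersetCard (pollSize G k p.2)} := by
  rw [Set.ofPred_exists]
  refine MeasurableSet.iUnion fun p => ?_
  have hp : Measurable fun ω : (V → Bool) × (ℕ × V → Finset (E × Bool)) => ω.2 p :=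
    (measurable_pi_apply p).comp measurable_snd
  exact hp (Set.toFinite {Q | Q ∉ (G.halfEdgesAt p.2).powersetCard (pollSize G k p.2)}).measurableSet

end Blue

/-! ### Poll sizes in the preferential attachment graph -/

theorem le_degree_paGraph {m t : ℕ} (e : PATree (t * m)) (v : Fin t) :
    m ≤ (paGraph e).degree v := by
  have hinj : Function.Injective fun y : Fin m => ((finProdFinEquiv (v, y) : Fin (t * m)), false) := by
    intro y y' h
    simpa using h
  have hsub : (Finset.univ.image fun y : Fin m => ((finProdFinEquiv (v, y) : Fin (t * m)), false))
      ⊆ (paGraph e).halfEdgesAt v := by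
    intro q hq
    obtain ⟨y, -, rfl⟩ := Finset.mem_image.1 hq
    rw [halfEdgesAt, Finset.mem_filter]
    exact ⟨Finset.mem_univ _, congrArg Prod.fst (finProdFinEquiv.symm_apply_apply (v, y))⟩
  have := Finset.card_le_card hsub
  rwa [Finset.card_image_of_injective _ hinj, Finset.card_univ, Fintype.card_fin] at this

theorem exists_dParam_eq {m k : ℕ} (hm : 5 ≤ m) (hk : 5 ≤ k) (hkodd : Odd k) :
    ∃ h, 2 ≤ h ∧ dParam m k = 2 * h + 1 := by
  obtain ⟨a, rfl⟩ := hkodd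
  unfold dParam
  split_ifs with hodd
  · obtain ⟨b, rfl⟩ := hodd
    exact ⟨min b a, by omega, by omega⟩
  · obtain ⟨b, rfl⟩ := Nat.not_odd_iff_even.1 hodd
    exact ⟨min (b - 1) a, by omega, by omega⟩

theorem exists_pollSize_eq {V E : Type*} [Fintype E] [DecidableEq V] {G : Multigraph V E}
    {m k h : ℕ} (hm : 5 ≤ m) (hkodd : Odd k) (hd : dParam m k = 2 * h + 1) {v : V}
    (hdeg : m ≤ G.degree v) : ∃ i, h ≤ i ∧ pollSize G k v = 2 * i + 1 := by
  obtain ⟨a, rfl⟩ := hkodd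
  have hmono : dParam m (2 * a + 1) ≤ pollSize G (2 * a + 1) v := by
    unfold dParam pollSize
    split_ifs with h1 h2 h2
    · omega
    -- For odd m and even degree the degree exceeds m, so dropping one half-edge still leaves m.
    · have : G.degree v ≠ m := by rintro h; exact h2 (h ▸ h1)
      omega
    · omega
    · omega
  have hodd : Odd (pollSize G (2 * a + 1) v) := by
    unfold pollSize
    split_ifs with h2
    · obtain ⟨b, hb⟩ := h2
      rw [hb]
      exact ⟨min a b, by omega⟩
    · obtain ⟨b, hb⟩ := Nat.not_odd_iff_even.1 h2
      rw [hb]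
      exact ⟨min a (b - 1), by omega⟩
  obtain ⟨i, hi⟩ := hodd
  exact ⟨i, by omega, hi⟩

/-! ### The joint law -/

theorem jointLaw_le {m k t : ℕ} (δ : ℝ≥0) (α : unitInterval)
    {D : PATree (t * m) → Set ((Fin t → Bool) × (ℕ × Fin t → Finset (Fin (t * m) × Bool)))}
    (hD : ∀ e, MeasurableSet (D e)) {X : Set (PATree (t * m))} {c : ℝ≥0∞}
    (hc : ∀ e ∉ X, protocolLaw (paGraph e) k α (D e) ≤ c) :
    jointLaw m k δ α t {x | x.1 ∈ X ∨ x.2 ∈ D x.1}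
      ≤ (paTreeLaw (δ / m) (t * m)).toMeasure X + c := by
  classical
  have hX : MeasurableSet X := (Set.toFinite X).measurableSet
  have hmark : IsMarkovKernel (Kernel.ofFunOfCountable
      fun e : PATree (t * m) => protocolLaw (paGraph e) k α) :=
    ⟨fun e => inferInstanceAs (IsProbabilityMeasure (protocolLaw (paGraph e) k α))⟩
  have hset : {x : PATree (t * m) × _ | x.1 ∈ X ∨ x.2 ∈ D x.1}
      = X ×ˢ Set.univ ∪ ⋃ e, {e} ×ˢ D e := by
    ext ⟨e, ω⟩
    simp
  have hmeas : MeasurableSet {x : PATree (t * m) × _ | x.1 ∈ X ∨ x.2 ∈ D x.1} := by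
    rw [hset]
    exact (hX.prod MeasurableSet.univ).union
      (MeasurableSet.iUnion fun e => (MeasurableSet.singleton e).prod (hD e))
  rw [jointLaw, Measure.compProd_apply hmeas]
  calc ∫⁻ e, protocolLaw (paGraph e) k α
        (Prod.mk e ⁻¹' {x | x.1 ∈ X ∨ x.2 ∈ D x.1}) ∂(paTreeLaw (δ / m) (t * m)).toMeasure
      ≤ ∫⁻ e, (X.indicator (fun _ => 1) e + c) ∂(paTreeLaw (δ / m) (t * m)).toMeasure := by
        refine lintegral_mono fun e => ?_
        by_cases he : e ∈ X
        · rw [Set.indicator_of_mem he]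
          exact prob_le_one.trans le_self_add
        · rw [Set.indicator_of_notMem he, zero_add]
          refine le_trans (measure_mono ?_) (hc e he)
          rintro ω (h | h)
          · exact absurd h he
          · exact h
    _ = _ := by
        rw [lintegral_add_right _ measurable_const, lintegral_indicator hX]
        simp

theorem jointLaw_not_blue_le {m k h t : ℕ} (hm : 5 ≤ m) (hkodd : Odd k)
    (hd : dParam m k = 2 * h + 1) (hh : 2 ≤ h) (A : ℝ) (hκ : 0 < kappaO A t) (δ : ℝ≥0)
    {α : unitInterval} (hα : (α : ℝ) < alphaStar (2 * h + 1)) {a b : ℕ} (hab : a ≤ b) :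
    jointLaw m k δ α t
        {x | ∀ T : ℕ, (T = a ∨ T = b) →
              BlueOutsideCore A x.1 x.2.1 x.2.2 (T + 1) ∧
              BlueOutsideCore A x.1 x.2.1 x.2.2 (T + 2)}ᶜ
      ≤ ENNReal.ofReal (∑ r ∈ Finset.range (6 * (b + 2) + 1), (r + 1) ^ r * ((√(kappaO A t))⁻¹ *
          (m * (∑ x : Fin t, (((x : ℕ) : ℝ) + 1)⁻¹ + (2 * r : ℕ))) ^ (2 * r)))
        + ENNReal.ofReal (4 * (2 * (t * m : ℕ)) * redSeq h α a) := by
  classical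
  -- The neighbours' times that decide the colours at T+1 and T+2. All are at most b+1, so cleanness
  -- up to length b+2 suffices.
  set S : Finset ℕ := {a, a + 1, b, b + 1} with hS
  set X : Set (PATree (t * m)) :=
    {e | ∃ v : Fin t, kappaO A t < (v : ℕ) + 1 ∧ (paGraph e).HasExcess (6 * (b + 2)) v} with hX
  set D : PATree (t * m) → Set ((Fin t → Bool) × (ℕ × Fin t → Finset (Fin (t * m) × Bool))) :=
    fun e => {ω | ∃ s ∈ S, ∃ h₀, (paGraph e).Clean (b + 2) h₀ ∧
        guardedColour (paGraph e) ω.1 ω.2 s h₀ = true} ∪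
      {ω | ∃ p : ℕ × Fin t, ω.2 p ∉
        ((paGraph e).halfEdgesAt p.2).powersetCard (pollSize (paGraph e) k p.2)} with hDdef
  have hpoll : ∀ (e : PATree (t * m)) (v : Fin t),
      ∃ i, h ≤ i ∧ pollSize (paGraph e) k v = 2 * i + 1 :=
    fun e v => exists_pollSize_eq hm hkodd hd (le_degree_paGraph e v)
  have hcover : {x : PATree (t * m) × ((Fin t → Bool) ×
        (ℕ × Fin t → Finset (Fin (t * m) × Bool))) | ∀ T : ℕ, (T = a ∨ T = b) →
              BlueOutsideCore A x.1 x.2.1 x.2.2 (T + 1) ∧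
              BlueOutsideCore A x.1 x.2.1 x.2.2 (T + 2)}ᶜ
      ⊆ {x | x.1 ∈ X ∨ x.2 ∈ D x.1} := by
    intro x hx
    by_contra hcon
    simp only [Set.mem_ofPred_eq, not_or] at hcon
    obtain ⟨hxX, hxD⟩ := hcon
    have hblue : ∀ s ∈ S, BlueOutsideCore A x.1 x.2.1 x.2.2 (s + 1) := by
      intro s hs v hv
      obtain ⟨i, hi, hq⟩ := hpoll x.1 v
      refine colour_succ_eq_false (k := k) (L := b + 2) (fun hex => hxX ⟨v, hv, hex⟩) ?_ (by omega) ?_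
      · by_contra hN
        exact hxD (Or.inr ⟨(s + 1, v), hN⟩)
      · intro h₀ hc hg
        exact hxD (Or.inl ⟨s, hs, h₀, hc, hg⟩)
    refine hx fun T hT => ?_
    rcases hT with rfl | rfl
    · exact ⟨hblue T (by simp [hS]), hblue (T + 1) (by simp [hS])⟩
    · exact ⟨hblue T (by simp [hS]), hblue (T + 1) (by simp [hS])⟩
  refine (measure_mono hcover).trans ?_
  refine (jointLaw_le δ α (c := ENNReal.ofReal (4 * (2 * (t * m : ℕ)) * redSeq h α a))
    (fun e => ?_) (fun e _ => ?_)).trans ?_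
  · exact (measurableSet_exists_guardedColour _ _ _).union (measurableSet_exists_poll_notMem _ _)
  · refine (measure_union_le _ _).trans ?_
    rw [measure_poll_notMem, add_zero, ← ofReal_measureReal]
    refine ENNReal.ofReal_le_ofReal ?_
    refine (measureReal_exists_guardedColour_le hh hα (hpoll e) (a := a) ?_).trans ?_
    · intro s hs
      simp only [hS, Finset.mem_insert, Finset.mem_singleton] at hs
      omega
    · have hr0 : 0 ≤ redSeq h α a := (redSeq_mem hh α.2.1 hα a).1
      have hc4 : (S.card : ℝ) ≤ 4 := by exact_mod_cast Finset.card_le_four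
      rw [Fintype.card_fin]
      gcongr
  · gcongr
    rw [← ofReal_measureReal]
    exact ENNReal.ofReal_le_ofReal (measureReal_hasExcess_le _ t m _ hκ)

/-! ### Asymptotics -/

theorem sum_inv_le_one_add_log (t : ℕ) :
    ∑ x : Fin t, (((x : ℕ) : ℝ) + 1)⁻¹ ≤ 1 + Real.log t := by
  refine le_trans (le_of_eq ?_) (harmonic_le_one_add_log t)
  rw [harmonic, Fin.sum_univ_eq_sum_range fun x : ℕ => ((x : ℝ) + 1)⁻¹]
  push_cast
  rfl

/-- Used with x = log t. The factors are at most x^M and (x²)^(2M), and there are M+1 ≤ x terms. -/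
theorem excess_sum_le {m M : ℕ} {x κ H : ℝ} (hM : (M : ℝ) + 1 ≤ x) (hm : 3 * (m : ℝ) ≤ x)
    (hH0 : 0 ≤ H) (hH : H ≤ 1 + x) :
    ∑ r ∈ Finset.range (M + 1), ((r : ℝ) + 1) ^ r * ((√κ)⁻¹ *
      (m * (H + (2 * r : ℕ))) ^ (2 * r)) ≤ x ^ (5 * M + 1) * (√κ)⁻¹ := by
  have hM0 : (0 : ℝ) ≤ M := Nat.cast_nonneg M
  have hx1 : 1 ≤ x := by linarith
  have hterm : ∀ r ∈ Finset.range (M + 1), ((r : ℝ) + 1) ^ r * ((√κ)⁻¹ *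
      (m * (H + (2 * r : ℕ))) ^ (2 * r)) ≤ x ^ (5 * M) * (√κ)⁻¹ := by
    intro r hr
    have hrM : r ≤ M := Nat.lt_succ_iff.1 (Finset.mem_range.1 hr)
    have hrM' : (r : ℝ) ≤ M := by exact_mod_cast hrM
    have h1 : ((r : ℝ) + 1) ^ r ≤ x ^ M :=
      (pow_le_pow_left₀ (by positivity) (by linarith) r).trans (pow_le_pow_right₀ hx1 hrM)
    have h2 : (m * (H + (2 * r : ℕ)) : ℝ) ≤ x ^ 2 := by
      push_cast
      have : H + 2 * (r : ℝ) ≤ 3 * x := by linarith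
      calc (m : ℝ) * (H + 2 * r) ≤ m * (3 * x) := by gcongr
        _ = (3 * m) * x := by ring
        _ ≤ x * x := by gcongr
        _ = x ^ 2 := by ring
    have h3 : (m * (H + (2 * r : ℕ)) : ℝ) ^ (2 * r) ≤ x ^ (4 * M) := by
      refine (pow_le_pow_left₀ (by positivity) h2 _).trans ?_
      rw [← pow_mul]
      exact pow_le_pow_right₀ hx1 (by omega)
    calc ((r : ℝ) + 1) ^ r * ((√κ)⁻¹ * (m * (H + (2 * r : ℕ))) ^ (2 * r))
        ≤ x ^ M * ((√κ)⁻¹ * x ^ (4 * M)) := by gcongr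
      _ = _ := by ring
  refine (Finset.sum_le_card_nsmul _ _ _ hterm).trans ?_
  rw [Finset.card_range, nsmul_eq_mul]
  push_cast
  calc ((M : ℝ) + 1) * (x ^ (5 * M) * (√κ)⁻¹) ≤ x * (x ^ (5 * M) * (√κ)⁻¹) := by gcongr
    _ = _ := by ring

theorem sqrt_kappaO_inv {A : ℝ} {t : ℕ} (hx : 0 < Real.log t) :
    (√(kappaO A t))⁻¹ = Real.exp (-(999 / 2 * A * Real.log (Real.log t) ^ 2)) := by
  rw [kappaO, omega, Real.sqrt_eq_rpow, ← Real.rpow_mul hx.le, Real.rpow_def_of_pos hx,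
    ← Real.exp_neg]
  congr 1
  ring

theorem tendsto_log_natCast : Tendsto (fun t : ℕ => Real.log t) atTop atTop :=
  Real.tendsto_log_atTop.comp tendsto_natCast_atTop_atTop

/-- In natural logarithms the base d cancels except inside the outer logarithm; hence h^τ_* = (log_d
t)^(1+ε). -/
theorem tauStar_eq {h : ℕ} (hh : 2 ≤ h) (ε : ℝ) (t : ℕ) :
    tauStar (2 * h + 1) ε t
      = (1 + ε) / Real.log h * Real.log (Real.log t / Real.log (2 * h + 1 : ℕ)) := by
  have hd : (((2 * h + 1 : ℕ) : ℝ) - 1) / 2 = h := by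
    push_cast
    ring
  have hlogh : Real.log h ≠ 0 := (Real.log_pos (by exact_mod_cast hh)).ne'
  have hlogd : Real.log (2 * h + 1 : ℕ) ≠ 0 :=
    (Real.log_pos (by exact_mod_cast (by omega : 1 < 2 * h + 1))).ne'
  rw [tauStar, hd]
  unfold Real.logb
  field_simp

theorem tauStar_le {h : ℕ} (hh : 2 ≤ h) {ε : ℝ} (hε : 0 < ε) {t : ℕ} (hx : 0 < Real.log t) :
    tauStar (2 * h + 1) ε t ≤ (1 + ε) / Real.log h * Real.log (Real.log t) := by
  have hlogh : 0 < Real.log h := Real.log_pos (by exact_mod_cast hh)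
  have hlogd : 1 ≤ Real.log (2 * h + 1 : ℕ) := by
    rw [Real.le_log_iff_exp_le (by positivity)]
    refine Real.exp_one_lt_d9.le.trans ?_
    have : (5 : ℝ) ≤ (2 * h + 1 : ℕ) := by exact_mod_cast (by omega : 5 ≤ 2 * h + 1)
    linarith
  rw [tauStar_eq hh]
  gcongr
  exact div_le_self hx.le hlogd

theorem tendsto_tauStar {h : ℕ} (hh : 2 ≤ h) {ε : ℝ} (hε : 0 < ε) :
    Tendsto (tauStar (2 * h + 1) ε) atTop atTop := by
  have hlogh : 0 < Real.log h := Real.log_pos (by exact_mod_cast hh)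
  have hlogd : 0 < Real.log (2 * h + 1 : ℕ) :=
    Real.log_pos (by exact_mod_cast (by omega : 1 < 2 * h + 1))
  rw [funext (tauStar_eq hh ε)]
  exact (Real.tendsto_log_atTop.comp (tendsto_log_natCast.atTop_div_const hlogd)).const_mul_atTop
    (by positivity)

theorem rpow_tauStar {h : ℕ} (hh : 2 ≤ h) (ε : ℝ) {t : ℕ} (hx : 0 < Real.log t) :
    (h : ℝ) ^ tauStar (2 * h + 1) ε t
      = (Real.log t / Real.log (2 * h + 1 : ℕ)) ^ (1 + ε) := by
  have hlogh : Real.log h ≠ 0 := (Real.log_pos (by exact_mod_cast hh)).ne'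
  have hlogd : 0 < Real.log (2 * h + 1 : ℕ) :=
    Real.log_pos (by exact_mod_cast (by omega : 1 < 2 * h + 1))
  have hh0 : (0 : ℝ) < h := by exact_mod_cast (by omega : 0 < h)
  rw [Real.rpow_def_of_pos hh0, Real.rpow_def_of_pos (div_pos hx hlogd), tauStar_eq hh]
  congr 1
  field_simp

/-- The number of edges of the configurations considered is at most a constant multiple of
`log log t`. -/
theorem six_mul_ceil_tauStar_le {h : ℕ} (hh : 2 ≤ h) {ε : ℝ} (hε : 0 < ε) {t : ℕ}
    (hx : 0 < Real.log t) (hy : 1 ≤ Real.log (Real.log t)) :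
    ((6 * (⌈tauStar (2 * h + 1) ε t⌉₊ + 2) : ℕ) : ℝ)
      ≤ 6 * ((1 + ε) / Real.log h + 3) * Real.log (Real.log t) := by
  have hlogh : 0 < Real.log h := Real.log_pos (by exact_mod_cast hh)
  have hle := tauStar_le hh hε hx
  have hc0 : 0 ≤ (1 + ε) / Real.log h * Real.log (Real.log t) := by positivity
  have hceil : (⌈tauStar (2 * h + 1) ε t⌉₊ : ℝ)
      ≤ (1 + ε) / Real.log h * Real.log (Real.log t) + 1 :=
    (Nat.cast_le.2 (Nat.ceil_mono hle)).trans (Nat.ceil_lt_add_one hc0).le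
  push_cast
  nlinarith

/-- With y = log log t and M ≤ Cy, the sum is at most exp((5Cy+1)y), against κ_o^(-1/2) =
exp(-(999/2)Ay²); A ≥ C is ample. -/
theorem tendsto_excess_sum (m : ℕ) {h : ℕ} (hh : 2 ≤ h) {ε : ℝ} (hε : 0 < ε) {A : ℝ}
    (hA : 6 * ((1 + ε) / Real.log h + 3) ≤ A) :
    Tendsto (fun t : ℕ => ∑ r ∈ Finset.range (6 * (⌈tauStar (2 * h + 1) ε t⌉₊ + 2) + 1),
      ((r : ℝ) + 1) ^ r * ((√(kappaO A t))⁻¹ *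
        (m * (∑ x : Fin t, (((x : ℕ) : ℝ) + 1)⁻¹ + (2 * r : ℕ))) ^ (2 * r))) atTop (𝓝 0) := by
  set C : ℝ := 6 * ((1 + ε) / Real.log h + 3) with hC
  have hlogh : 0 < Real.log h := Real.log_pos (by exact_mod_cast hh)
  have hC18 : 18 ≤ C := by
    have : 0 ≤ (1 + ε) / Real.log h := by positivity
    linarith
  have hxt := tendsto_log_natCast
  have hyt : Tendsto (fun t : ℕ => Real.log (Real.log t)) atTop atTop :=
    Real.tendsto_log_atTop.comp hxt
  have hsmall : ∀ᶠ x : ℝ in atTop, C * Real.log x + 1 ≤ x := by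
    have h1 : (fun x : ℝ => C * Real.log x + 1) =o[atTop] id :=
      (Real.isLittleO_log_id_atTop.const_mul_left C).add
        (Asymptotics.isLittleO_const_id_atTop (1 : ℝ))
    filter_upwards [h1.bound one_pos, eventually_ge_atTop 0] with x hx hx0
    rw [one_mul, Real.norm_eq_abs, Real.norm_eq_abs, id, abs_of_nonneg hx0] at hx
    exact (le_abs_self _).trans hx
  have hbound : ∀ᶠ t : ℕ in atTop,
      ∑ r ∈ Finset.range (6 * (⌈tauStar (2 * h + 1) ε t⌉₊ + 2) + 1),
        ((r : ℝ) + 1) ^ r * ((√(kappaO A t))⁻¹ *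
          (m * (∑ x : Fin t, (((x : ℕ) : ℝ) + 1)⁻¹ + (2 * r : ℕ))) ^ (2 * r))
        ≤ Real.exp (-Real.log (Real.log t)) := by
    filter_upwards [hxt.eventually_gt_atTop 0, hxt.eventually_ge_atTop (3 * (m : ℝ)),
      hyt.eventually_ge_atTop 1, hxt.eventually hsmall] with t hx0 hxm hy hxs
    have hM := six_mul_ceil_tauStar_le hh hε hx0 hy
    rw [← hC] at hM
    set M := 6 * (⌈tauStar (2 * h + 1) ε t⌉₊ + 2) with hMdef
    set y := Real.log (Real.log t) with hydef
    refine (excess_sum_le (by linarith) hxm (Finset.sum_nonneg fun x _ => by positivity)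
      (sum_inv_le_one_add_log t)).trans ?_
    rw [sqrt_kappaO_inv hx0, ← hydef]
    have hpow : Real.log t ^ (5 * M + 1) = Real.exp ((5 * M + 1) * y) := by
      rw [← Real.exp_log hx0, ← hydef, ← Real.exp_nat_mul]
      push_cast
      rfl
    rw [hpow, ← Real.exp_add, Real.exp_le_exp]
    have hyy : y ≤ y ^ 2 := by nlinarith
    have h1 : (5 * (M : ℝ) + 1) * y ≤ (5 * (C * y) + 1) * y := by gcongr
    have h2 : 999 / 2 * C * y ^ 2 ≤ 999 / 2 * A * y ^ 2 := by gcongr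
    have h3 : 18 * y ^ 2 ≤ C * y ^ 2 := by gcongr
    nlinarith
  refine squeeze_zero' (Eventually.of_forall fun t => ?_) hbound
    (Real.tendsto_exp_neg_atTop_nhds_zero.comp hyt)
  refine Finset.sum_nonneg fun r _ => ?_
  have : 0 ≤ ∑ x : Fin t, (((x : ℕ) : ℝ) + 1)⁻¹ := Finset.sum_nonneg fun x _ => by positivity
  positivity

theorem tendsto_mul_redSeq (m : ℕ) {h : ℕ} (hh : 2 ≤ h) {ε : ℝ} (hε : 0 < ε) {α : ℝ} (h0 : 0 ≤ α)
    (hα : α < alphaStar (2 * h + 1)) :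
    Tendsto (fun t : ℕ => 4 * (2 * ((t * m : ℕ) : ℝ)) *
      redSeq h α ⌊tauStar (2 * h + 1) ε t⌋₊) atTop (𝓝 0) := by
  obtain ⟨s₀, hs₀⟩ := exists_redSeq_le_exp hh h0 hα
  have hlogd : 0 < Real.log (2 * h + 1 : ℕ) :=
    Real.log_pos (by exact_mod_cast (by omega : 1 < 2 * h + 1))
  have hh0 : (0 : ℝ) < h := by exact_mod_cast (by omega : 0 < h)
  have hh1 : (1 : ℝ) ≤ h := by exact_mod_cast (by omega : 1 ≤ h)
  -- Absorbs the rounding of τ_*, the s₀ initial steps and the base d. The spare (log t)^ε outgrows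
  -- 2/c, so the red probability is at most t^(-2).
  set c : ℝ := (h : ℝ) ^ (-(1 + s₀ : ℝ)) * (Real.log (2 * h + 1 : ℕ) ^ (1 + ε))⁻¹ with hc
  have hc0 : 0 < c := by positivity
  have hxt := tendsto_log_natCast
  have hpow : Tendsto (fun t : ℕ => Real.log t ^ ε) atTop atTop :=
    (tendsto_rpow_atTop hε).comp hxt
  have hbound : ∀ᶠ t : ℕ in atTop, 4 * (2 * ((t * m : ℕ) : ℝ)) *
      redSeq h α ⌊tauStar (2 * h + 1) ε t⌋₊ ≤ 8 * m * Real.exp (-Real.log t) := by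
    filter_upwards [hxt.eventually_gt_atTop 0, eventually_gt_atTop 0,
      (tendsto_tauStar hh hε).eventually_ge_atTop (s₀ + 1 : ℝ),
      hpow.eventually_ge_atTop (2 / c)] with t hx0 ht0 hτ hp
    set τ := tauStar (2 * h + 1) ε t with hτdef
    have ht0' : (0 : ℝ) < t := by exact_mod_cast ht0
    have hfl : s₀ ≤ ⌊τ⌋₊ := Nat.le_floor (by linarith)
    obtain ⟨s, hs⟩ := Nat.exists_eq_add_of_le hfl
    have hsge : τ - (1 + s₀) ≤ s := by
      have h1 := Nat.lt_floor_add_one τ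
      rw [hs] at h1
      push_cast at h1
      linarith
    have hpows : c * Real.log t ^ (1 + ε) ≤ (h : ℝ) ^ s := by
      calc c * Real.log t ^ (1 + ε) = (h : ℝ) ^ (τ - (1 + s₀)) := by
            rw [sub_eq_add_neg, Real.rpow_add hh0, hτdef, rpow_tauStar hh ε hx0,
              Real.div_rpow hx0.le hlogd.le, hc]
            ring
        _ ≤ (h : ℝ) ^ (s : ℝ) := Real.rpow_le_rpow_of_exponent_le hh1 hsge
        _ = (h : ℝ) ^ s := Real.rpow_natCast _ _
    have hge : 2 * Real.log t ≤ (h : ℝ) ^ s := by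
      refine le_trans ?_ hpows
      rw [Real.rpow_add hx0, Real.rpow_one]
      rw [div_le_iff₀ hc0] at hp
      nlinarith
    have hred : redSeq h α ⌊τ⌋₊ ≤ Real.exp (-(2 * Real.log t)) := by
      rw [hs]
      refine (hs₀ s).trans ?_
      gcongr
    have hte : (t : ℝ) = Real.exp (Real.log t) := (Real.exp_log ht0').symm
    calc 4 * (2 * ((t * m : ℕ) : ℝ)) * redSeq h α ⌊τ⌋₊
        ≤ 4 * (2 * ((t * m : ℕ) : ℝ)) * Real.exp (-(2 * Real.log t)) := by gcongr
      _ = 8 * m * (t * Real.exp (-(2 * Real.log t))) := by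
          push_cast
          ring
      _ = 8 * m * Real.exp (-Real.log t) := by
          congr 1
          conv_lhs => rw [hte]
          rw [Real.log_exp, ← Real.exp_add]
          congr 1
          ring
  refine squeeze_zero' (Eventually.of_forall fun t => ?_) hbound ?_
  · have := (redSeq_mem hh h0 hα ⌊tauStar (2 * h + 1) ε t⌋₊).1
    positivity
  · have := (Real.tendsto_exp_neg_atTop_nhds_zero.comp hxt).const_mul (8 * (m : ℝ))
    rwa [mul_zero] at this

end MajorityPA

end

/-! ### The main theorem -/

open MajorityPA in
theorem mainTheorem3 (m k : ℕ) (hm : 5 ≤ m) (hk : 5 ≤ k) (hkodd : Odd k)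
    (ε : ℝ) (hε : 0 < ε) :
    ∃ A₀ : ℝ, ∀ A : ℝ, A₀ ≤ A →
      ∀ (δ : ℝ≥0) (α : unitInterval), (α : ℝ) < alphaStar (dParam m k) →
        Tendsto
          (fun t : ℕ => jointLaw m k δ α t
            {x | ∀ T : ℕ, (T = ⌊tauStar (dParam m k) ε t⌋₊ ∨ T = ⌈tauStar (dParam m k) ε t⌉₊) →
              BlueOutsideCore A x.1 x.2.1 x.2.2 (T + 1) ∧
              BlueOutsideCore A x.1 x.2.1 x.2.2 (T + 2)})
          atTop (𝓝 1) := by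
  obtain ⟨h, hh, hd⟩ := exists_dParam_eq hm hk hkodd
  -- A set of excess edges has at most 6(⌈τ_*⌉+2) elements, and this constant times log log t bounds
  -- that number.
  refine ⟨6 * ((1 + ε) / Real.log h + 3), fun A hA δ α hα => ?_⟩
  rw [hd] at hα ⊢
  have hlim := (ENNReal.tendsto_ofReal (tendsto_excess_sum m hh hε hA)).add
    (ENNReal.tendsto_ofReal (tendsto_mul_redSeq m hh hε α.2.1 hα))
  have hlim' := ENNReal.Tendsto.sub (tendsto_const_nhds (x := (1 : ℝ≥0∞))) hlim
    (Or.inl ENNReal.one_ne_top)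
  rw [ENNReal.ofReal_zero, add_zero, tsub_zero] at hlim'
  refine tendsto_of_tendsto_of_tendsto_of_le_of_le' hlim' tendsto_const_nhds ?_
    (Eventually.of_forall fun t => prob_le_one)
  filter_upwards [tendsto_log_natCast.eventually_gt_atTop 0] with t hx0
  have hκ : 0 < kappaO A t := Real.rpow_pos_of_pos hx0 _
  rw [tsub_le_iff_right]
  refine le_trans ?_ (add_le_add_right (jointLaw_not_blue_le hm hkodd hd hh A hκ δ hα
    (Nat.floor_le_ceil (tauStar (2 * h + 1) ε t))) _)
  rw [← measure_univ (μ := jointLaw m k δ α t)]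
  refine le_trans (le_of_eq ?_) (measure_union_le _ _)
  rw [Set.union_compl_self]
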